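/- Setting. Let $(X,\Phi,Y,\Phi^\vee)$ be a reduced root datum with finite root system $\Phi\subset X$, with a choice of simple roots and positive roots $\Phi^+$; let $W$ be its Weyl group, $l$ the length function with respect to the simple reflections, $\leqslant$ the Bruhat order, and $r_\beta\in W$ the reflection in $\beta\in\Phi$. Let $\hat T(\mathbb C)=\operatorname{Hom}(X,\mathbb C^\times)$; write $\mathbf z^\lambda$ for the value of $\mathbf z\in\hat T(\mathbb C)$ at $\lambda\in X$, let $W$ act by $(w\mathbf z)^\lambda=\mathbf z^{w^{-1}\lambda}$, and call $\mathbf z$ regular if $\mathbf z^\alpha\neq1$ for all $\alpha\in\Phi$. Let $q$ be an indeterminate and let $f\mapsto\overline f$ be the $\mathbb C$-algebra involution of $\mathbb C[q,q^{-1}]$ with $\overline q=q^{-1}$ (so $\mathbf z$ is left unchanged). Let $\mathcal H$ be the Iwahori--Hecke algebra of $W$ over $\mathbb C[q,q^{-1}]$, with basis $T_w$ $(w\in W)$, where $T_wT_{w'}=T_{ww'}$ if $l(ww')=l(w)+l(w')$ and $T_s^2=(q-1)T_s+q$ for simple reflections $s$. Let $\Lambda:\mathcal H\to\mathbb C[q,q^{-1}]$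 be the linear functional with $\Lambda(T_1)=1$ and $\Lambda(T_w)=0$ for $w\ne1$, and let $\psi_u=\sum_{x\geqslant u}T_x$. For regular $\mathbf z$ let $\mu_{\mathbf z}(w)\in\mathcal H$ be determined by $\mu_{\mathbf z}(1)=1$, by \[\mu_{\mathbf z}(s_\alpha)=q^{-1}T_{s_\alpha}+(1-q^{-1})\frac{\mathbf z^\alpha}{1-\mathbf z^\alpha}\] for simple roots $\alpha$, and by $\mu_{\mathbf z}(w_1w_2)=\mu_{\mathbf z}(w_2)\,\mu_{w_2\mathbf z}(w_1)$ whenever $l(w_1w_2)=l(w_1)+l(w_2)$. For $u,v\in W$ put \[m_{u,v}(\mathbf z)=\Lambda(\psi_u\,\mu_{\mathbf z}(v)),\qquad S(u,v)=\{\beta\in\Phi^+ : u\leqslant v\,r_\beta<v\}.\] Statement. Let $u<v$ in $W$ and let $s=s_\alpha$ be the simple reflection attached to a simple root $\alpha$, such that $sv<v$ and $u<su$. Then $S(u,v)$ is the disjoint union \[S(u,v)=S(u,sv)\sqcup\{-v^{-1}\alpha\},\] and for every regular $\mathbf z\in\hat T(\mathbb C)$ \[\overline{m_{u,v}}(\mathbf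 z)=\left(\frac{1-q\,\mathbf z^{-v^{-1}\alpha}}{1-\mathbf z^{-v^{-1}\alpha}}\right)\overline{m_{u,sv}}(\mathbf z).\] -/

import Mathlib

noncomputable section

namespace CasselmanBasis

open scoped LaurentPolynomial
open RootPairing

/-! ### The Weyl group of a root datum, its length function and its Bruhat order -/

section Weyl

variable {ι X Y : Type*} [AddCommGroup X] [AddCommGroup Y] {P : RootPairing ι ℤ X Y}

/-- The reflection `r_β` in the root `β` with index `i`, as an element of the Weyl group. -/
def refl (P : RootPairing ι ℤ X Y) (i : ι) : P.weylGroup := weylGroup.ofIdx P i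

/-- The simple reflection attached to a simple root. -/
def simpleRefl (b : P.Base) (a : b.support) : P.weylGroup := refl P a

/-- The product in the Weyl group of a word in the simple reflections. -/
def wordProd (b : P.Base) (L : List b.support) : P.weylGroup := (L.map (simpleRefl b)).prod

/-- The length of `w`: the least length of a word in the simple reflections with product `w`. -/
def length (b : P.Base) (w : P.weylGroup) : ℕ :=
  sInf {n | ∃ L : List b.support, wordProd b L = w ∧ L.length = n}

/-- The Bruhat order: the reflexive and transitive closure of the relations
`x < x r_β`, where `r_β` is a reflection with `length x < length (x r_β)`. -/
def BruhatLE (b : P.Base) : P.weylGroup → P.weylGroup → Prop :=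
  Relation.ReflTransGen fun x y => ∃ i : ι, y = x * refl P i ∧ length b x < length b y

/-- The strict Bruhat order. -/
def BruhatLT (b : P.Base) (x y : P.weylGroup) : Prop := BruhatLE b x y ∧ x ≠ y

/-- `S(u, v)`: the set of positive roots `β` with `u ≤ v r_β < v`. -/
def setS (b : P.Base) (u v : P.weylGroup) : Set X :=
  {β | ∃ i : ι, P.root i = β ∧ b.IsPos i ∧
    BruhatLE b u (v * refl P i) ∧ BruhatLT b (v * refl P i) v}

theorem refl_reflectionPerm (i j : ι) :
    refl P (P.reflectionPerm j i) = refl P j * refl P i * refl P j := by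
  apply Subtype.ext
  apply Equiv.weightHom_injective P
  simp only [refl, weylGroup.ofIdx, Subgroup.coe_mul, map_mul, Equiv.weightHom_apply,
    Equiv.reflection_weightEquiv, reflection_reflectionPerm]

variable [Finite ι] [P.IsReduced]

theorem refl_mem_closure (b : P.Base) (i : ι) :
    refl P i ∈ Submonoid.closure (Set.range (simpleRefl b)) := by
  refine b.induction_reflect i (p := fun i =>
    refl P i ∈ Submonoid.closure (Set.range (simpleRefl b))) ?_ ?_ ?_
  · intro i hi
    rw [refl_reflectionPerm]
    exact mul_mem (mul_mem hi hi) hi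
  · intro i hi
    exact Submonoid.subset_closure ⟨⟨i, hi⟩, rfl⟩
  · intro i j hi hj
    have hj' : refl P j ∈ Submonoid.closure (Set.range (simpleRefl b)) :=
      Submonoid.subset_closure ⟨⟨j, hj⟩, rfl⟩
    rw [refl_reflectionPerm]
    exact mul_mem (mul_mem hj' hi) hj'

theorem exists_word (b : P.Base) (w : P.weylGroup) : ∃ L : List b.support, wordProd b L = w := by
  have key : ∀ w ∈ Submonoid.closure (Set.range (simpleRefl b)),
      ∃ L : List b.support, wordProd b L = w := by
    intro w hw
    induction hw using Submonoid.closure_induction with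
    | mem x hx =>
      obtain ⟨a, rfl⟩ := hx
      exact ⟨[a], by simp [wordProd]⟩
    | one => exact ⟨[], by simp [wordProd]⟩
    | mul x y _ _ hx hy =>
      obtain ⟨L, rfl⟩ := hx
      obtain ⟨M, rfl⟩ := hy
      exact ⟨L ++ M, by simp [wordProd]⟩
  apply key
  obtain ⟨g, hg⟩ := w
  induction hg using weylGroup.induction with
  | mem i => exact refl_mem_closure b i
  | one => exact one_mem _
  | mul x y hx hy h1 h2 => exact mul_mem h1 h2

theorem exists_reducedWord (b : P.Base) (w : P.weylGroup) :
    ∃ L : List b.support, wordProd b L = w ∧ L.length = length b w := by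
  obtain ⟨L, hL⟩ := exists_word b w
  exact Nat.sInf_mem (s := {n | ∃ L : List b.support, wordProd b L = w ∧ L.length = n})
    ⟨_, L, hL, rfl⟩

/-- A reduced word for `w`. -/
def reducedWord (b : P.Base) (w : P.weylGroup) : List b.support := (exists_reducedWord b w).choose

end Weyl

section Finiteness

variable {ι X Y : Type*} [AddCommGroup X] [AddCommGroup Y] {P : RootPairing ι ℤ X Y}

theorem smul_sub_mem_rootSpan (w : P.weylGroup) (x : X) : w • x - x ∈ P.rootSpan ℤ := by
  obtain ⟨g, hg⟩ := w
  revert x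
  induction hg using weylGroup.induction with
  | mem i =>
    intro x
    change P.reflection i x - x ∈ _
    rw [reflection_apply, sub_sub_cancel_left]
    exact neg_mem (Submodule.smul_mem _ _ (Submodule.subset_span ⟨i, rfl⟩))
  | one => intro x; change x - x ∈ _; simp
  | mul g h hg hh h1 h2 =>
    intro x
    have e : (⟨g * h, mul_mem hg hh⟩ : P.weylGroup) • x - x =
        ((⟨g, hg⟩ : P.weylGroup) • ((⟨h, hh⟩ : P.weylGroup) • x) - (⟨h, hh⟩ : P.weylGroup) • x) +
          ((⟨h, hh⟩ : P.weylGroup) • x - x) := by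
      rw [sub_add_sub_cancel, ← mul_smul]; rfl
    rw [e]
    exact add_mem (h1 _) (h2 _)

theorem smul_eq_of_forall_root [Finite ι] (w : P.weylGroup) (hw : ∀ i, w • P.root i = P.root i) (x : X) :
    w • x = x := by
  have := Fintype.ofFinite ι
  have inv : ∀ (w : P.weylGroup) (x y : X), P.RootForm (w • x) (w • y) = P.RootForm x y := by
    rintro ⟨g, hg⟩
    induction hg using weylGroup.induction with
    | mem i => intro x y; exact P.rootForm_reflection_reflection_apply i x y
    | one => intro x y; rfl
    | mul g h hg hh h1 h2 => intro x y; exact (h1 _ _).trans (h2 x y)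
  have hd := smul_sub_mem_rootSpan w x
  have h0 : ∀ y ∈ P.rootSpan ℤ, P.RootForm (w • x - x) y = 0 := by
    intro y hy
    induction hy using Submodule.span_induction with
    | mem y hy =>
      obtain ⟨i, rfl⟩ := hy
      rw [map_sub, LinearMap.sub_apply, ← inv w x, hw, sub_self]
    | zero => simp
    | add y z _ _ hy hz => rw [map_add, hy, hz, add_zero]
    | smul a y _ hy => rw [map_smul, hy, smul_zero]
  exact sub_eq_zero.mp (P.eq_zero_of_mem_rootSpan_of_rootForm_self_eq_zero hd (h0 _ hd))

instance finite_weylGroup [Finite ι] : Finite P.weylGroup := by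
  refine Finite.of_injective (P.weylGroupToPerm) ((injective_iff_map_eq_one _).mpr ?_)
  intro w hw
  apply Subtype.ext
  apply Equiv.weightHom_injective P
  ext x
  refine smul_eq_of_forall_root w (fun i => ?_) x
  rw [weylGroup_apply_root, hw]
  rfl

end Finiteness

/-! ### The complex torus -/

section Torus

variable {ι X Y : Type*} [AddCommGroup X] [AddCommGroup Y] {P : RootPairing ι ℤ X Y}

/-- The complex points of the torus with character lattice `X`: the homomorphisms from `X` to the
multiplicative group of `ℂ`. The value `z l` is what is usually written `z ^ l`. -/
abbrev Torus (X : Type*) [AddCommGroup X] : Type _ := AddChar X ℂ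

/-- `z` is regular if `z ^ α ≠ 1` for all roots `α`. -/
def IsRegular (P : RootPairing ι ℤ X Y) (z : Torus X) : Prop := ∀ i : ι, z (P.root i) ≠ 1

/-- The action of the Weyl group on the torus: `(w z) ^ l = z ^ (w⁻¹ l)`. -/
def torusAct (w : P.weylGroup) (z : Torus X) : Torus X :=
  z.compAddMonoidHom (DistribSMul.toAddMonoidHom X w⁻¹)

end Torus

/-! ### The Iwahori-Hecke algebra over the ring of Laurent polynomials in `q` -/

section Hecke

variable {ι X Y : Type*} [AddCommGroup X] [AddCommGroup Y] {P : RootPairing ι ℤ X Y}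

/-- The indeterminate `q`. -/
def q : ℂ[T;T⁻¹] := LaurentPolynomial.T 1

/-- The inverse of the indeterminate `q`. -/
def qInv : ℂ[T;T⁻¹] := LaurentPolynomial.T (-1)

/-- The involution `q ↦ q⁻¹`; it fixes the complex numbers, hence everything
that depends on `z` alone. -/
def bar : ℂ[T;T⁻¹] ≃ₐ[ℂ] ℂ[T;T⁻¹] := LaurentPolynomial.invert

open Classical in
/-- Left multiplication by `T_s` on the free module with basis `(T_w)`:
`T_s T_w = T_{sw}` if `sw > w`, and `T_s T_w = (q - 1) T_w + q T_{sw}` if `sw < w`. -/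
def leftMul (b : P.Base) (a : b.support) :
    Module.End ℂ[T;T⁻¹] (P.weylGroup →₀ ℂ[T;T⁻¹]) :=
  Finsupp.linearCombination ℂ[T;T⁻¹] fun w =>
    if length b w < length b (simpleRefl b a * w) then
      Finsupp.single (simpleRefl b a * w) 1
    else
      (q - 1) • Finsupp.single w 1 + q • Finsupp.single (simpleRefl b a * w) 1

/-- The Iwahori-Hecke algebra of the Weyl group, in its (faithful) left regular representation on
the free module with basis `(T_w)`: the algebra generated by the left multiplications by
the `T_s`. An element `h` corresponds to the vector `h T_1`. -/
abbrev Hecke (b : P.Base) : Subalgebra ℂ[T;T⁻¹] (Module.End ℂ[T;T⁻¹] (P.weylGroup →₀ ℂ[T;T⁻¹])) :=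
  Algebra.adjoin ℂ[T;T⁻¹] (Set.range (leftMul b))

/-- The generator `T_s` of the Hecke algebra. -/
def TSimple (b : P.Base) (a : b.support) : Hecke b :=
  ⟨leftMul b a, Algebra.subset_adjoin ⟨a, rfl⟩⟩

/-- The functional `Λ` with `Λ(T_1) = 1` and `Λ(T_w) = 0` for `w ≠ 1`. -/
def Lam (b : P.Base) (h : Hecke b) : ℂ[T;T⁻¹] := h.1 (Finsupp.single 1 1) 1

/-- `μ_z(s) = q⁻¹ T_s + (1 - q⁻¹) z^α / (1 - z^α)` for the simple reflection `s = s_α`. -/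
def muSimple (b : P.Base) (z : Torus X) (a : b.support) : Hecke b :=
  qInv • TSimple b a +
    algebraMap ℂ[T;T⁻¹] (Hecke b)
      ((1 - qInv) * LaurentPolynomial.C (z (P.root a) / (1 - z (P.root a))))

/-- The element `μ_z` computed along a word, by the rule
`μ_z(s w) = μ_z(w) μ_{wz}(s)`. -/
def muWord (b : P.Base) (z : Torus X) : List b.support → Hecke b
  | [] => 1
  | a :: L => muWord b z L * muSimple b (torusAct (wordProd b L) z) a

variable [Finite ι] [P.IsReduced]

/-- The basis element `T_w = T_{s_1} ⋯ T_{s_n}`, where `w = s_1 ⋯ s_n` is a reduced word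
(the result does not depend on the word). -/
def TBasis (b : P.Base) (w : P.weylGroup) : Hecke b := ((reducedWord b w).map (TSimple b)).prod

open Classical in
/-- `ψ_w`, the sum of the `T_x` over all `x ≥ w`. -/
def psi (b : P.Base) (w : P.weylGroup) : Hecke b :=
  have := Fintype.ofFinite P.weylGroup
  ∑ x : P.weylGroup with BruhatLE b w x, TBasis b x

/-- `μ_z(w)`, computed along a reduced word (for regular `z` the result does not depend
on the word), so that `μ_z(w₁ w₂) = μ_z(w₂) μ_{w₂ z}(w₁)` whenever
`length (w₁ w₂) = length w₁ + length w₂`. -/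
def mu (b : P.Base) (z : Torus X) (w : P.weylGroup) : Hecke b := muWord b z (reducedWord b w)

/-- `m_{u,v}(z) = Λ(ψ_u μ_z(v))`, a Laurent polynomial in `q` for each regular `z`. -/
def m (b : P.Base) (u v : P.weylGroup) (z : Torus X) : ℂ[T;T⁻¹] := Lam b (psi b u * mu b z v)

end Hecke

end CasselmanBasis

end

/-! Both claims rest on the lifting property `BruhatLE.simpleRefl_mul`: when `u < s u`, the set of
all `x ≥ u` is stable under left multiplication by `s`.

For the set `S(u, v)`: if `r_β` is not `v⁻¹ s v`, left multiplication by `s` preserves the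
inequality between `v r_β` and `v`, and lifting carries `u ≤ v r_β` to `u ≤ s v r_β` and back. The
one excluded reflection belongs to the positive root `-v⁻¹ α`, for which `v r_β = s v`.

For the formula: stability gives `T_s ψ_u = q ψ_u`, since `T_x + T_{sx}` is an eigenvector of `T_s`
with eigenvalue `q`. Write `μ_z(v) = μ_z(s v) μ_{svz}(s)`. Because `Λ` is a trace, the last factor
can be moved in front of `ψ_u`, where it acts by the scalar `q⁻¹ q + (1 - q⁻¹) t / (1 - t) = (1 -
q⁻¹ t) / (1 - t)` with `t = z ^ (-v⁻¹ α)`. The bar involution turns this into the stated factor.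

The laborious point is the factorisation of `μ_z(v)`, as `mu` uses a chosen reduced word, which need
not begin with `s`. Independence of the word (`muWord_eq_of_reduced`) is an induction in the style
of Matsumoto's theorem. It reduces to braid relations for the `μ_z(s)` in types A1 × A1, A2, B2 and
G2, which amount to identities between the fractions `t / (1 - t)`. -/

noncomputable section

namespace CasselmanBasis

open scoped LaurentPolynomial
open RootPairing

/-! ### Roots, reflections and the action of the Weyl group -/

section WeylGeometry

variable {ι X Y : Type*} [AddCommGroup X] [AddCommGroup Y] {P : RootPairing ι ℤ X Y}

/-- The permutation of the root indices induced by an element of the Weyl group. -/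
def rootPerm (w : P.weylGroup) (i : ι) : ι := P.weylGroupToPerm w i

theorem root_rootPerm (w : P.weylGroup) (i : ι) : P.root (rootPerm w i) = w • P.root i :=
  (weylGroup_apply_root P w i).symm

@[simp] theorem rootPerm_one (i : ι) : rootPerm (1 : P.weylGroup) i = i := by simp [rootPerm]

theorem rootPerm_mul (w w' : P.weylGroup) (i : ι) :
    rootPerm (w * w') i = rootPerm w (rootPerm w' i) := by simp [rootPerm]

theorem rootPerm_refl (i j : ι) : rootPerm (refl P i) j = P.reflectionPerm i j := by
  apply P.root.injective
  rw [root_rootPerm, root_reflectionPerm]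
  rfl

theorem refl_smul (i : ι) (x : X) : refl P i • x = P.reflection i x := rfl

theorem weylGroup_ext {w w' : P.weylGroup} (h : ∀ x : X, w • x = w' • x) : w = w' := by
  apply Subtype.ext
  apply Equiv.weightHom_injective P
  ext x
  exact h x

@[simp] theorem refl_mul_self (i : ι) : refl P i * refl P i = 1 :=
  weylGroup_ext fun x => by
    rw [mul_smul, refl_smul, refl_smul, reflection_same, one_smul]

@[simp] theorem refl_inv (i : ι) : (refl P i)⁻¹ = refl P i :=
  inv_eq_of_mul_eq_one_right (refl_mul_self i)

@[simp] theorem refl_mul_refl_mul (i : ι) (w : P.weylGroup) : refl P i * (refl P i * w) = w := by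
  rw [← mul_assoc, refl_mul_self, one_mul]

@[simp] theorem mul_refl_mul_refl (i : ι) (w : P.weylGroup) : w * refl P i * refl P i = w := by
  rw [mul_assoc, refl_mul_self, mul_one]

theorem refl_reflectionPerm_self (i : ι) : refl P (P.reflectionPerm i i) = refl P i := by
  rw [refl_reflectionPerm, refl_mul_self, one_mul]

theorem refl_rootPerm (w : P.weylGroup) (i : ι) :
    refl P (rootPerm w i) = w * refl P i * w⁻¹ := by
  obtain ⟨g, hg⟩ := w
  induction hg using weylGroup.induction generalizing i with
  | mem j =>
    have h := refl_reflectionPerm (P := P) i j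
    rw [← rootPerm_refl] at h
    change refl P (rootPerm (refl P j) i) = refl P j * refl P i * (refl P j)⁻¹
    rw [h, refl_inv]
  | one =>
    change refl P (rootPerm 1 i) = 1 * refl P i * 1⁻¹
    simp
  | mul g h hg hh h1 h2 =>
    rw [show (⟨g * h, mul_mem hg hh⟩ : P.weylGroup) = ⟨g, hg⟩ * ⟨h, hh⟩ from rfl, rootPerm_mul,
      h1, h2, mul_inv_rev]
    simp only [mul_assoc]

theorem refl_mul_eq (w : P.weylGroup) (i : ι) :
    refl P i * w = w * refl P (rootPerm w⁻¹ i) := by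
  rw [refl_rootPerm]; group

theorem mul_refl_eq (w : P.weylGroup) (i : ι) :
    w * refl P i = refl P (rootPerm w i) * w := by
  rw [refl_rootPerm]; group

theorem root_neg (i : ι) : P.root (P.reflectionPerm i i) = -P.root i := by
  rw [root_reflectionPerm, reflection_apply_self]

theorem isPos_neg_iff (b : P.Base) (i : ι) : b.IsPos (P.reflectionPerm i i) ↔ ¬ b.IsPos i :=
  Base.IsPos.neg_iff_not b i

theorem rootPerm_neg (w : P.weylGroup) (i : ι) :
    rootPerm w (P.reflectionPerm i i) = P.reflectionPerm (rootPerm w i) (rootPerm w i) := by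
  apply P.root.injective
  rw [root_rootPerm, root_neg, root_neg, root_rootPerm, smul_neg]

/-- Applying both reflections to the root `i` shows that twice this root is a multiple of the root
`j`. In a reduced system this forces the two roots to agree up to sign, and positivity fixes the
sign. -/
theorem refl_injective_of_isPos [P.IsReduced] (b : P.Base) {i j : ι} (hi : b.IsPos i)
    (hj : b.IsPos j) (h : refl P i = refl P j) : i = j := by
  by_contra hij
  have h1 : rootPerm (refl P i) i = rootPerm (refl P j) i := by rw [h]
  have h3 := congrArg P.root h1
  rw [root_rootPerm, root_rootPerm, refl_smul, refl_smul, reflection_apply_self,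
    reflection_apply_root] at h3
  have hli := IsReduced.linearIndependent P hij fun hn => by
    rw [← root_neg] at hn
    rw [P.root.injective hn, isPos_neg_iff] at hi
    exact hi hj
  rw [LinearIndependent.pair_iff] at hli
  have := (hli 2 (-P.pairing i j) (by
    rw [neg_smul, two_smul]
    nth_rw 2 [← neg_neg (P.root i)]
    rw [h3]; abel)).1
  norm_num at this

theorem isPos_simple (b : P.Base) (a : b.support) : b.IsPos (a : ι) :=
  Base.isPos_of_mem_support a.2

/-! ### Length and the exchange property -/

section Length

variable (b : P.Base)

@[simp] theorem wordProd_nil : wordProd b [] = 1 := rfl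

@[simp] theorem wordProd_cons (a : b.support) (L : List b.support) :
    wordProd b (a :: L) = simpleRefl b a * wordProd b L := by simp [wordProd]

@[simp] theorem wordProd_append (L M : List b.support) :
    wordProd b (L ++ M) = wordProd b L * wordProd b M := by simp [wordProd]

theorem length_wordProd_le (L : List b.support) : length b (wordProd b L) ≤ L.length :=
  Nat.sInf_le ⟨L, rfl, rfl⟩

variable [Finite ι] [P.IsReduced]

variable {b} in
theorem eq_of_isPos_of_not_isPos {a : b.support} {i : ι} (hi : b.IsPos i)
    (h : ¬ b.IsPos (rootPerm (simpleRefl b a) i)) : i = a := by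
  by_contra hia
  exact h (by
    rw [simpleRefl, rootPerm_refl]
    exact hi.reflectionPerm a.2 hia)

/-- The strong exchange property. Applying the letters from the right, the root turns negative at
some letter `a`, and a simple reflection makes only its own positive root negative. So the part of
the word after `a` sends `i` to `a`; pulled to the left through that part, `r_i` becomes `s_a` and
cancels the letter. -/
theorem exists_delete (L : List b.support) {i : ι} (hi : b.IsPos i)
    (h : ¬ b.IsPos (rootPerm (wordProd b L) i)) :
    ∃ L' : List b.support, wordProd b L' = wordProd b L * refl P i ∧
      L'.length + 1 = L.length := by
  induction L with
  | nil => simp [hi] at h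
  | cons a L ih =>
    by_cases hL : b.IsPos (rootPerm (wordProd b L) i)
    · rw [wordProd_cons, rootPerm_mul] at h
      refine ⟨L, ?_, rfl⟩
      rw [wordProd_cons, mul_assoc, mul_refl_eq, eq_of_isPos_of_not_isPos hL h, simpleRefl,
        refl_mul_refl_mul]
    · obtain ⟨L', h1, h2⟩ := ih hL
      exact ⟨a :: L', by rw [wordProd_cons, wordProd_cons, h1, mul_assoc], by simpa using h2⟩

theorem wordProd_reducedWord (w : P.weylGroup) : wordProd b (reducedWord b w) = w :=
  (exists_reducedWord b w).choose_spec.1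

theorem length_reducedWord (w : P.weylGroup) : (reducedWord b w).length = length b w :=
  (exists_reducedWord b w).choose_spec.2

omit [Finite ι] [P.IsReduced] in
theorem length_one : length b (1 : P.weylGroup) = 0 :=
  Nat.le_zero.mp (length_wordProd_le b [])

theorem length_mul_refl_lt_of_isPos {w : P.weylGroup} {i : ι} (hi : b.IsPos i)
    (h : ¬ b.IsPos (rootPerm w i)) : length b (w * refl P i) < length b w := by
  obtain ⟨L', h1, h2⟩ := exists_delete b (reducedWord b w) hi (by rwa [wordProd_reducedWord])
  rw [wordProd_reducedWord] at h1
  have := length_wordProd_le b L'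
  rw [h1] at this
  rw [← length_reducedWord b w]
  omega

theorem length_mul_refl_lt_of_sign {w : P.weylGroup} {i : ι}
    (h : ¬ (b.IsPos i ↔ b.IsPos (rootPerm w i))) : length b (w * refl P i) < length b w := by
  by_cases hi : b.IsPos i
  · exact length_mul_refl_lt_of_isPos b hi (by tauto)
  · rw [← refl_reflectionPerm_self]
    apply length_mul_refl_lt_of_isPos b
    · rwa [isPos_neg_iff]
    · rw [rootPerm_neg, isPos_neg_iff]; tauto

/-- Replacing `w` by `w r_i` reverses the sign of the image of `i`, so the exchange property applied
to `w r_i` gives the converse. -/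
theorem length_mul_refl_lt_iff {w : P.weylGroup} {i : ι} :
    length b (w * refl P i) < length b w ↔ ¬ (b.IsPos i ↔ b.IsPos (rootPerm w i)) := by
  refine ⟨fun h h' => ?_, length_mul_refl_lt_of_sign b⟩
  have := length_mul_refl_lt_of_sign b (w := w * refl P i) (i := i) (by
    rw [rootPerm_mul, rootPerm_refl, rootPerm_neg, isPos_neg_iff]; tauto)
  rw [mul_refl_mul_refl] at this
  omega

theorem lt_length_mul_refl_iff {w : P.weylGroup} {i : ι} :
    length b w < length b (w * refl P i) ↔ (b.IsPos i ↔ b.IsPos (rootPerm w i)) := by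
  have := length_mul_refl_lt_iff b (w := w * refl P i) (i := i)
  rw [mul_refl_mul_refl, rootPerm_mul, rootPerm_refl, rootPerm_neg, isPos_neg_iff] at this
  rw [this]; tauto

theorem length_mul_refl_ne (w : P.weylGroup) (i : ι) : length b (w * refl P i) ≠ length b w := by
  have h1 := length_mul_refl_lt_iff b (w := w) (i := i)
  have h2 := lt_length_mul_refl_iff b (w := w) (i := i)
  by_cases h : b.IsPos i ↔ b.IsPos (rootPerm w i)
  · exact (h2.mpr h).ne'
  · exact (h1.mpr h).ne

theorem length_refl_mul_ne (w : P.weylGroup) (i : ι) : length b (refl P i * w) ≠ length b w := by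
  rw [refl_mul_eq]
  exact length_mul_refl_ne b _ _

theorem length_simpleRefl_mul_lt_iff {w : P.weylGroup} {a : b.support} :
    length b (simpleRefl b a * w) < length b w ↔ ¬ b.IsPos (rootPerm w⁻¹ a) := by
  rw [simpleRefl, refl_mul_eq, length_mul_refl_lt_iff, ← rootPerm_mul, mul_inv_cancel,
    rootPerm_one]
  have := isPos_simple b a
  tauto

theorem length_simpleRefl_mul_le (w : P.weylGroup) (a : b.support) :
    length b (simpleRefl b a * w) ≤ length b w + 1 := by
  have := length_wordProd_le b (a :: reducedWord b w)
  rwa [wordProd_cons, wordProd_reducedWord, List.length_cons, length_reducedWord] at this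

theorem length_mul_simpleRefl_le (w : P.weylGroup) (a : b.support) :
    length b (w * simpleRefl b a) ≤ length b w + 1 := by
  have := length_wordProd_le b (reducedWord b w ++ [a])
  rwa [wordProd_append, wordProd_cons, wordProd_nil, mul_one, wordProd_reducedWord,
    List.length_append, length_reducedWord] at this

theorem length_le_simpleRefl_mul (w : P.weylGroup) (a : b.support) :
    length b w ≤ length b (simpleRefl b a * w) + 1 := by
  simpa [simpleRefl] using length_simpleRefl_mul_le b (simpleRefl b a * w) a

theorem length_le_mul_simpleRefl (w : P.weylGroup) (a : b.support) :
    length b w ≤ length b (w * simpleRefl b a) + 1 := by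
  simpa [simpleRefl] using length_mul_simpleRefl_le b (w * simpleRefl b a) a

end Length

/-! ### The Bruhat order and its lifting property -/

section Bruhat

variable {b : P.Base}

theorem BruhatLE.of_lt {x : P.weylGroup} {i : ι} (h : length b x < length b (x * refl P i)) :
    BruhatLE b x (x * refl P i) :=
  Relation.ReflTransGen.single ⟨i, rfl, h⟩

theorem BruhatLE.trans {x y z : P.weylGroup} (h : BruhatLE b x y) (h' : BruhatLE b y z) :
    BruhatLE b x z :=
  Relation.ReflTransGen.trans h h'

theorem BruhatLE.length_le {x y : P.weylGroup} (h : BruhatLE b x y) :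
    length b x ≤ length b y := by
  induction h with
  | refl => exact le_rfl
  | tail _ h ih =>
    obtain ⟨i, -, h⟩ := h
    omega

theorem BruhatLT.length_lt {x y : P.weylGroup} (h : BruhatLT b x y) :
    length b x < length b y := by
  obtain ⟨h, hne⟩ := h
  rcases Relation.ReflTransGen.cases_tail h with h | ⟨z, hz, i, -, hi⟩
  · exact absurd h.symm hne
  · exact (BruhatLE.length_le hz).trans_lt hi

theorem bruhatLT_mul_refl_iff {x : P.weylGroup} {i : ι} :
    BruhatLT b (x * refl P i) x ↔ length b (x * refl P i) < length b x := by
  refine ⟨BruhatLT.length_lt, fun h => ⟨?_, fun h' => by rw [h'] at h; omega⟩⟩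
  have := BruhatLE.of_lt (b := b) (x := x * refl P i) (i := i) (by rwa [mul_refl_mul_refl])
  rwa [mul_refl_mul_refl] at this

theorem bruhatLE_simpleRefl_mul {x : P.weylGroup} {a : b.support}
    (h : length b x < length b (simpleRefl b a * x)) : BruhatLE b x (simpleRefl b a * x) := by
  rw [simpleRefl, refl_mul_eq] at h ⊢
  exact BruhatLE.of_lt h

theorem simpleRefl_mul_bruhatLE {x : P.weylGroup} {a : b.support}
    (h : length b (simpleRefl b a * x) < length b x) : BruhatLE b (simpleRefl b a * x) x := by
  have := bruhatLE_simpleRefl_mul (b := b) (x := simpleRefl b a * x) (a := a)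
    (by simpa [simpleRefl] using h)
  simpa [simpleRefl] using this

variable [Finite ι] [P.IsReduced]

/-- Whether `r_i` lengthens `x` depends only on the signs of `i` and `x i`. Left multiplication by
`s_a` changes the sign of `x i` only if `x i` is `±a`, and then `x r_i = s_a x`. -/
theorem length_simpleRefl_mul_lt_or_eq {x : P.weylGroup} {i : ι} (a : b.support)
    (h : length b x < length b (x * refl P i)) :
    length b (simpleRefl b a * x) < length b (simpleRefl b a * x * refl P i) ∨
      simpleRefl b a * x = x * refl P i := by
  wlog hi : b.IsPos i generalizing i
  · have := this (i := P.reflectionPerm i i)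
    rw [refl_reflectionPerm_self, isPos_neg_iff] at this
    exact this h hi
  rw [lt_length_mul_refl_iff] at h ⊢
  by_cases hx : b.IsPos (rootPerm (simpleRefl b a * x) i)
  · tauto
  · right
    rw [rootPerm_mul] at hx
    rw [mul_refl_eq, eq_of_isPos_of_not_isPos (h.mp hi) hx, simpleRefl]

open Classical in
/-- The smaller one of `x` and `s x`. -/
def lowerRep (a : b.support) (x : P.weylGroup) : P.weylGroup :=
  if length b (simpleRefl b a * x) < length b x then simpleRefl b a * x else x

omit [Finite ι] [P.IsReduced] in
theorem lowerRep_le (a : b.support) (x : P.weylGroup) : BruhatLE b (lowerRep a x) x := by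
  unfold lowerRep
  split_ifs with h
  · exact simpleRefl_mul_bruhatLE h
  · exact Relation.ReflTransGen.refl

theorem lowerRep_le_simpleRefl_mul (a : b.support) (x : P.weylGroup) :
    BruhatLE b (lowerRep a x) (simpleRefl b a * x) := by
  unfold lowerRep
  split_ifs with h
  · exact Relation.ReflTransGen.refl
  · exact bruhatLE_simpleRefl_mul
      (lt_of_le_of_ne (not_lt.mp h) (length_refl_mul_ne b x a).symm)

theorem lowerRep_simpleRefl_mul (a : b.support) (x : P.weylGroup) :
    lowerRep a (simpleRefl b a * x) = lowerRep a x := by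
  have := length_refl_mul_ne b x a
  unfold lowerRep
  rw [simpleRefl, refl_mul_refl_mul]
  rcases lt_or_gt_of_ne this with h | h
  · rw [if_neg (by omega), if_pos h]
  · rw [if_pos h, if_neg (by omega)]

/-- Passing to the shorter element of each coset `{x, s x}` is monotone. It suffices to follow one
elementary step `y < y r_i`: either `s` carries it to a step `s y < s y r_i`, or both ends lie in
the same coset. -/
theorem BruhatLE.lowerRep {x y : P.weylGroup} (a : b.support) (h : BruhatLE b x y) :
    BruhatLE b (lowerRep a x) (lowerRep a y) := by
  induction h with
  | refl => exact Relation.ReflTransGen.refl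
  | @tail y z _ h ih =>
    refine ih.trans ?_
    obtain ⟨i, rfl, hi⟩ := h
    rcases length_simpleRefl_mul_lt_or_eq a hi with h | h
    · by_cases hz : length b (simpleRefl b a * (y * refl P i)) < length b (y * refl P i)
      · rw [CasselmanBasis.lowerRep.eq_1 (x := y * refl P i), if_pos hz, ← mul_assoc]
        exact (lowerRep_le_simpleRefl_mul a y).trans (BruhatLE.of_lt h)
      · rw [CasselmanBasis.lowerRep.eq_1 (x := y * refl P i), if_neg hz]
        exact (lowerRep_le a y).trans (BruhatLE.of_lt hi)
    · rw [← h, lowerRep_simpleRefl_mul]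
      exact Relation.ReflTransGen.refl

/-- The lifting property of the Bruhat order, in the form: if `u < s u` and `u ≤ x`
then `u ≤ s x`. -/
theorem BruhatLE.simpleRefl_mul {u x : P.weylGroup} {a : b.support} (h : BruhatLE b u x)
    (hu : length b u < length b (simpleRefl b a * u)) : BruhatLE b u (simpleRefl b a * x) := by
  have h1 := h.lowerRep a
  rw [CasselmanBasis.lowerRep.eq_1 (x := u), if_neg (by omega)] at h1
  exact h1.trans (lowerRep_le_simpleRefl_mul a x)

end Bruhat

/-! ### The decomposition of `S(u, v)` -/

section SetS

variable {b : P.Base} {u v : P.weylGroup} {a : b.support}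

theorem mem_setS_iff {i : ι} : P.root i ∈ setS b u v ↔ b.IsPos i ∧
    BruhatLE b u (v * refl P i) ∧ length b (v * refl P i) < length b v := by
  simp only [setS, Set.mem_ofPred_eq, bruhatLT_mul_refl_iff, EmbeddingLike.apply_eq_iff_eq]
  exact exists_eq_left

variable [Finite ι] [P.IsReduced]

theorem setS_eq_union (huv : BruhatLE b u v)
    (hv : length b (simpleRefl b a * v) < length b v)
    (hu : length b u < length b (simpleRefl b a * u)) :
    setS b u v = setS b u (simpleRefl b a * v) ∪ {-(v⁻¹ • P.root a)} ∧
      Disjoint (setS b u (simpleRefl b a * v)) {-(v⁻¹ • P.root a)} := by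
  set j := P.reflectionPerm (rootPerm v⁻¹ a) (rootPerm v⁻¹ a) with hj
  have hroot : -(v⁻¹ • P.root a) = P.root j := by rw [hj, root_neg, root_rootPerm]
  have hpos : b.IsPos j := by rwa [hj, isPos_neg_iff, ← length_simpleRefl_mul_lt_iff]
  have hvj : v * refl P j = simpleRefl b a * v := by
    rw [hj, refl_reflectionPerm_self, simpleRefl, refl_mul_eq]
  have hss : ∀ w : P.weylGroup, simpleRefl b a * (simpleRefl b a * w) = w := by
    intro w; rw [simpleRefl, refl_mul_refl_mul]
  have hj_notMem : P.root j ∉ setS b u (simpleRefl b a * v) := by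
    rw [mem_setS_iff, mul_assoc, hvj, hss]
    rintro ⟨-, -, h⟩
    omega
  rw [hroot, Set.disjoint_singleton_right]
  refine ⟨?_, hj_notMem⟩
  ext β
  constructor
  · rintro ⟨i, rfl, hi⟩
    by_cases hij : i = j
    · right; rw [hij]; rfl
    left
    have hi : P.root i ∈ setS b u v := ⟨i, rfl, hi⟩
    rw [mem_setS_iff] at hi ⊢
    obtain ⟨hi, hui, hl⟩ := hi
    refine ⟨hi, ?_, ?_⟩
    · rw [mul_assoc]; exact hui.simpleRefl_mul hu
    · rcases length_simpleRefl_mul_lt_or_eq (x := v * refl P i) (i := i) a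
        (by rwa [mul_refl_mul_refl]) with h | h
      · rwa [← mul_assoc, mul_refl_mul_refl] at h
      · refine absurd (refl_injective_of_isPos b hi hpos ?_) hij
        rw [mul_refl_mul_refl] at h
        rw [← mul_right_inj v, hvj]
        nth_rw 2 [← h]
        rw [hss]
  · rintro (⟨i, rfl, hi⟩ | rfl)
    · have hi : P.root i ∈ setS b u (simpleRefl b a * v) := ⟨i, rfl, hi⟩
      have hij : i ≠ j := by rintro rfl; exact hj_notMem hi
      rw [mem_setS_iff] at hi ⊢
      obtain ⟨hi, hui, hl⟩ := hi
      refine ⟨hi, ?_, ?_⟩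
      · have := hui.simpleRefl_mul hu
        rwa [mul_assoc, hss] at this
      · rcases length_simpleRefl_mul_lt_or_eq (x := simpleRefl b a * v * refl P i) (i := i) a
          (by rwa [mul_refl_mul_refl]) with h | h
        · rwa [mul_assoc (simpleRefl b a) v, hss, mul_refl_mul_refl] at h
        · refine absurd (refl_injective_of_isPos b hi hpos ?_) hij
          rw [mul_refl_mul_refl, mul_assoc, hss] at h
          rw [← mul_right_inj v, hvj, h]
    · rw [mem_setS_iff, hvj]
      exact ⟨hpos, huv.simpleRefl_mul hu, hv⟩

end SetS

end WeylGeometry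

/-! ### The Hecke algebra and its regular representation -/

section HeckeModule

variable {ι X Y : Type*} [AddCommGroup X] [AddCommGroup Y] {P : RootPairing ι ℤ X Y}

theorem q_mul_qInv : q * qInv = 1 := by
  rw [q, qInv, ← LaurentPolynomial.T_add]; simp

/-- The vector corresponding to `T_w`. -/
def basisVec (w : P.weylGroup) : P.weylGroup →₀ ℂ[T;T⁻¹] := Finsupp.single w 1

variable {b : P.Base}

theorem leftMul_of_lt {a : b.support} {w : P.weylGroup}
    (h : length b w < length b (simpleRefl b a * w)) :
    leftMul b a (basisVec w) = basisVec (simpleRefl b a * w) := by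
  rw [leftMul, basisVec, Finsupp.linearCombination_single, if_pos h, one_smul, basisVec]

theorem leftMul_of_gt {a : b.support} {w : P.weylGroup}
    (h : length b (simpleRefl b a * w) < length b w) :
    leftMul b a (basisVec w) = (q - 1) • basisVec w + q • basisVec (simpleRefl b a * w) := by
  rw [leftMul, basisVec, Finsupp.linearCombination_single, if_neg (by omega), one_smul, basisVec]

open Classical in
/-- Right multiplication by `T_s` on the free module with basis `(T_w)`. -/
def rightMul (b : P.Base) (a : b.support) :
    Module.End ℂ[T;T⁻¹] (P.weylGroup →₀ ℂ[T;T⁻¹]) :=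
  Finsupp.linearCombination ℂ[T;T⁻¹] fun w =>
    if length b w < length b (w * simpleRefl b a) then
      basisVec (w * simpleRefl b a)
    else
      (q - 1) • basisVec w + q • basisVec (w * simpleRefl b a)

theorem rightMul_of_lt {a : b.support} {w : P.weylGroup}
    (h : length b w < length b (w * simpleRefl b a)) :
    rightMul b a (basisVec w) = basisVec (w * simpleRefl b a) := by
  rw [rightMul, basisVec, Finsupp.linearCombination_single, if_pos h, one_smul, basisVec]

theorem rightMul_of_gt {a : b.support} {w : P.weylGroup}
    (h : length b (w * simpleRefl b a) < length b w) :
    rightMul b a (basisVec w) = (q - 1) • basisVec w + q • basisVec (w * simpleRefl b a) := by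
  rw [rightMul, basisVec, Finsupp.linearCombination_single, if_neg (by omega), one_smul, basisVec,
    basisVec]

theorem linearMap_ext_basisVec {M : Type*} [AddCommMonoid M] [Module ℂ[T;T⁻¹] M]
    {f g : (P.weylGroup →₀ ℂ[T;T⁻¹]) →ₗ[ℂ[T;T⁻¹]] M}
    (h : ∀ w, f (basisVec w) = g (basisVec w)) : f = g :=
  Finsupp.lhom_ext' fun w => LinearMap.ext_ring (h w)

@[simp] theorem simpleRefl_mul_simpleRefl_mul (a : b.support) (w : P.weylGroup) :
    simpleRefl b a * (simpleRefl b a * w) = w := refl_mul_refl_mul _ _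

@[simp] theorem mul_simpleRefl_mul_simpleRefl (a : b.support) (w : P.weylGroup) :
    w * simpleRefl b a * simpleRefl b a = w := mul_refl_mul_refl _ _

theorem basisVec_apply_one_of_ne {w : P.weylGroup} (h : w ≠ 1) : basisVec w 1 = 0 :=
  Finsupp.single_eq_of_ne h.symm

variable [Finite ι] [P.IsReduced]

/-- If multiplying by `s` on the left changes the effect of `t` on the length, then `s w = w t`. -/
theorem simpleRefl_mul_eq_mul_simpleRefl {a c : b.support} {w : P.weylGroup}
    (h : ¬ (length b w < length b (w * simpleRefl b c) ↔
      length b (simpleRefl b a * w) < length b (simpleRefl b a * w * simpleRefl b c))) :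
    simpleRefl b a * w = w * simpleRefl b c := by
  by_cases hw : length b w < length b (w * simpleRefl b c)
  · rcases length_simpleRefl_mul_lt_or_eq a hw with h' | h'
    · exact absurd ⟨fun _ => h', fun _ => hw⟩ h
    · exact h'
  · have hne := length_mul_refl_ne b w c
    have h1 : length b (w * simpleRefl b c) < length b (w * simpleRefl b c * refl P c) := by
      simp only [simpleRefl, mul_refl_mul_refl] at hw hne ⊢; omega
    rcases length_simpleRefl_mul_lt_or_eq a h1 with h' | h'
    · exfalso
      simp only [simpleRefl, ← mul_assoc, mul_refl_mul_refl] at h h' hw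
      exact h ⟨fun h => absurd h hw, fun h => absurd h h'.not_gt⟩
    · rw [simpleRefl, simpleRefl, mul_refl_mul_refl] at h'
      rw [← h', simpleRefl, simpleRefl]
      nth_rw 1 [← h']
      rw [refl_mul_refl_mul]

theorem length_lt_or_gt_left (b : P.Base) (a : b.support) (w : P.weylGroup) :
    length b w < length b (simpleRefl b a * w) ∨ length b (simpleRefl b a * w) < length b w :=
  (lt_or_gt_of_ne (length_refl_mul_ne b w a)).symm

theorem length_lt_or_gt_right (b : P.Base) (a : b.support) (w : P.weylGroup) :
    length b w < length b (w * simpleRefl b a) ∨ length b (w * simpleRefl b a) < length b w :=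
  (lt_or_gt_of_ne (length_mul_refl_ne b w a)).symm

/-- Unless `s w = w t`, the effect of `s` on the length is the same at `w` and at `w t`, and that of
`t` the same at `w` and at `s w`, so both orders give the same expansion. In the exceptional case
`s` and `t` move `w` to the same element, and a direct computation remains. -/
theorem leftMul_rightMul_comm (b : P.Base) (a c : b.support) :
    leftMul b a * rightMul b c = rightMul b c * leftMul b a := by
  apply linearMap_ext_basisVec
  intro w
  simp only [Module.End.mul_apply]
  by_cases h : simpleRefl b a * w = w * simpleRefl b c
  · have e1 : simpleRefl b a * w * simpleRefl b c = w := by rw [h, mul_simpleRefl_mul_simpleRefl]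
    have e2 : simpleRefl b a * (w * simpleRefl b c) = w := by rw [← mul_assoc, e1]
    rcases length_lt_or_gt_right b c w with h1 | h1
    · rw [rightMul_of_lt h1, leftMul_of_gt (by rwa [e2]), leftMul_of_lt (w := w) (by rwa [h]),
        rightMul_of_gt (by rwa [e1, h]), e1, e2, h]
    · rw [rightMul_of_gt h1, leftMul_of_gt (by rwa [h])]
      simp only [map_add, map_smul]
      rw [rightMul_of_gt h1, leftMul_of_gt (by rwa [h]), leftMul_of_lt (by rwa [e2]),
        rightMul_of_lt (by rwa [e1, h]), e1, e2, h]
  · have hl := not_imp_comm.mp (simpleRefl_mul_eq_mul_simpleRefl (a := a) (c := c) (w := w)) h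
    -- Each multiplication changes the length by exactly one, so the statement about `t` in `hl`
    -- forces the one about `s`.
    have hr : length b w < length b (simpleRefl b a * w) ↔
        length b (w * simpleRefl b c) < length b (simpleRefl b a * (w * simpleRefl b c)) := by
      have h1 := length_lt_or_gt_right b c w
      have h2 := length_lt_or_gt_right b c (simpleRefl b a * w)
      have h3 := length_lt_or_gt_left b a w
      have h4 := length_lt_or_gt_left b a (w * simpleRefl b c)
      have h5 := length_mul_simpleRefl_le b w c
      have h6 := length_le_mul_simpleRefl b w c
      have h7 := length_mul_simpleRefl_le b (simpleRefl b a * w) c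
      have h8 := length_le_mul_simpleRefl b (simpleRefl b a * w) c
      have h9 := length_simpleRefl_mul_le b w a
      have h10 := length_le_simpleRefl_mul b w a
      rw [← mul_assoc] at *
      omega
    rcases length_lt_or_gt_right b c w with h1 | h1 <;>
    rcases length_lt_or_gt_left b a w with h2 | h2
    · rw [rightMul_of_lt h1, leftMul_of_lt h2, leftMul_of_lt (hr.mp h2),
        rightMul_of_lt (hl.mp h1), mul_assoc]
    · have h3 := (length_lt_or_gt_left b a (w * simpleRefl b c)).resolve_left
        (fun h => by have := hr.mpr h; omega)
      rw [rightMul_of_lt h1, leftMul_of_gt h2, leftMul_of_gt h3]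
      simp only [map_add, map_smul]
      rw [rightMul_of_lt h1, rightMul_of_lt (hl.mp h1), mul_assoc]
    · have h3 := (length_lt_or_gt_right b c (simpleRefl b a * w)).resolve_left
        (fun h => by have := hl.mpr h; omega)
      rw [rightMul_of_gt h1, leftMul_of_lt h2, rightMul_of_gt h3]
      simp only [map_add, map_smul]
      rw [leftMul_of_lt h2, leftMul_of_lt (hr.mp h2), mul_assoc]
    · have h3 := (length_lt_or_gt_left b a (w * simpleRefl b c)).resolve_left
        (fun h => by have := hr.mpr h; omega)
      have h4 := (length_lt_or_gt_right b c (simpleRefl b a * w)).resolve_left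
        (fun h => by have := hl.mpr h; omega)
      rw [rightMul_of_gt h1, leftMul_of_gt h2]
      simp only [map_add, map_smul]
      rw [rightMul_of_gt h1, leftMul_of_gt h2, leftMul_of_gt h3, rightMul_of_gt h4, mul_assoc]
      module

/-- The algebra is generated by left multiplications. Commuting with right multiplications makes an
element recoverable from its value at `T_1`, and lets identities in the algebra be checked on that
single vector. -/
theorem hecke_rightMul_comm (h : Hecke b) (c : b.support) (x : P.weylGroup →₀ ℂ[T;T⁻¹]) :
    h.1 (rightMul b c x) = rightMul b c (h.1 x) := by
  have key : h.1 * rightMul b c = rightMul b c * h.1 := by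
    obtain ⟨h, hh⟩ := h
    induction hh using Algebra.adjoin_induction with
    | mem x hx =>
      obtain ⟨a, rfl⟩ := hx
      exact leftMul_rightMul_comm b a c
    | algebraMap r => exact Algebra.commutes r _
    | add x y _ _ hx hy => simp only at hx hy ⊢; rw [add_mul, mul_add, hx, hy]
    | mul x y _ _ hx hy => simp only at hx hy ⊢; rw [mul_assoc, hy, ← mul_assoc, hx, mul_assoc]
  exact LinearMap.congr_fun key x

/-- Every `w ≠ 1` has a right descent. -/
theorem exists_right_descent {w : P.weylGroup} (h : w ≠ 1) :
    ∃ a : b.support, length b (w * simpleRefl b a) < length b w := by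
  rcases List.eq_nil_or_concat (reducedWord b w) with hL | ⟨M, a, hL⟩
  · exact absurd (by rw [← wordProd_reducedWord b w, hL, wordProd_nil]) h
  · refine ⟨a, ?_⟩
    have h1 := length_wordProd_le b M
    have h2 : wordProd b M = w * simpleRefl b a := by
      rw [← wordProd_reducedWord b w, hL]; simp
    rw [h2] at h1
    rw [← length_reducedWord b w, hL]
    simp; omega

/-- An element of the Hecke algebra is determined by its value at `T_1`. -/
theorem hecke_ext {h h' : Hecke b} (e : h.1 (basisVec 1) = h'.1 (basisVec 1)) : h = h' := by
  apply Subtype.ext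
  apply linearMap_ext_basisVec
  intro w
  induction hn : length b w using Nat.strong_induction_on generalizing w with
  | _ n ih =>
    by_cases hw : w = 1
    · rw [hw, e]
    · obtain ⟨a, ha⟩ := exists_right_descent (b := b) hw
      -- A right descent `s` gives `T_w = T_{ws} T_s`, which reduces the value at `T_w` to the value
      -- at the shorter `T_{ws}`.
      have h1 : basisVec w = rightMul b a (basisVec (w * simpleRefl b a)) := by
        rw [rightMul_of_lt (by rwa [mul_simpleRefl_mul_simpleRefl]), mul_simpleRefl_mul_simpleRefl]
      rw [h1, hecke_rightMul_comm, hecke_rightMul_comm, ih _ (by rwa [← hn]) _ rfl]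

theorem wordProd_cons_reduced {a : b.support} {L : List b.support}
    (h : length b (wordProd b (a :: L)) = (a :: L).length) :
    length b (wordProd b L) = L.length ∧
      length b (wordProd b L) < length b (simpleRefl b a * wordProd b L) := by
  have h1 := length_wordProd_le b L
  have h2 := length_simpleRefl_mul_le b (wordProd b L) a
  rw [wordProd_cons, List.length_cons] at h
  omega

theorem prod_TSimple_apply_one {L : List b.support}
    (h : length b (wordProd b L) = L.length) :
    ((L.map (TSimple b)).prod).1 (basisVec 1) = basisVec (wordProd b L) := by
  induction L with
  | nil => simp
  | cons a L ih =>
    obtain ⟨h1, h2⟩ := wordProd_cons_reduced h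
    rw [List.map_cons, List.prod_cons, MulMemClass.coe_mul, Module.End.mul_apply, ih h1,
      wordProd_cons]
    exact leftMul_of_lt h2

/-- Both products send `T_1` to the same basis vector. This supplies the braid relations among the
`T_s`. -/
theorem prod_TSimple_eq {L M : List b.support} (hL : length b (wordProd b L) = L.length)
    (hM : length b (wordProd b M) = M.length) (h : wordProd b L = wordProd b M) :
    (L.map (TSimple b)).prod = (M.map (TSimple b)).prod :=
  hecke_ext (by rw [prod_TSimple_apply_one hL, prod_TSimple_apply_one hM, h])

theorem TBasis_apply_one (w : P.weylGroup) : (TBasis b w).1 (basisVec 1) = basisVec w := by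
  rw [TBasis, prod_TSimple_apply_one, wordProd_reducedWord]
  rw [wordProd_reducedWord, length_reducedWord]

theorem TSimple_mul_self (a : b.support) :
    TSimple b a * TSimple b a = (q - 1) • TSimple b a + q • 1 := by
  have h1 : length b (1 : P.weylGroup) < length b (simpleRefl b a * 1) := by
    have := length_refl_mul_ne b 1 a
    rw [length_one] at this ⊢
    exact Nat.pos_of_ne_zero this
  apply hecke_ext
  change leftMul b a (leftMul b a (basisVec 1)) =
    (q - 1) • leftMul b a (basisVec 1) + q • basisVec 1
  rw [leftMul_of_lt h1, leftMul_of_gt (by rwa [simpleRefl_mul_simpleRefl_mul]),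
    simpleRefl_mul_simpleRefl_mul]

/-! ### The trace property of `Λ` -/

section Trace

/-- For `w` equal to `1` or `s`, left and right multiplication by `s` agree. For any other `w`, none
of `w`, `s w`, `w s` is `1`, so neither side has a `T_1` term. -/
theorem leftMul_apply_one (a : b.support) (x : P.weylGroup →₀ ℂ[T;T⁻¹]) :
    leftMul b a x 1 = rightMul b a x 1 := by
  have key : (Finsupp.lapply 1).comp (leftMul b a) = (Finsupp.lapply 1).comp (rightMul b a) := by
    apply linearMap_ext_basisVec
    intro w
    change leftMul b a (basisVec w) 1 = rightMul b a (basisVec w) 1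
    by_cases hw : w = simpleRefl b a
    · have h1 : simpleRefl b a * w = w * simpleRefl b a := by rw [hw]
      rcases length_lt_or_gt_left b a w with h | h
      · rw [leftMul_of_lt h, rightMul_of_lt (by rwa [← h1]), h1]
      · rw [leftMul_of_gt h, rightMul_of_gt (by rwa [← h1]), h1]
    by_cases hw1 : w = 1
    · have h1 : simpleRefl b a * w = w * simpleRefl b a := by rw [hw1, one_mul, mul_one]
      rcases length_lt_or_gt_left b a w with h | h
      · rw [leftMul_of_lt h, rightMul_of_lt (by rwa [← h1]), h1]
      · rw [leftMul_of_gt h, rightMul_of_gt (by rwa [← h1]), h1]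
    have hl : simpleRefl b a * w ≠ 1 := fun h => hw (by
      rw [← simpleRefl_mul_simpleRefl_mul (b := b) a w, h, mul_one])
    have hr : w * simpleRefl b a ≠ 1 := fun h => hw (by
      rw [← mul_simpleRefl_mul_simpleRefl (b := b) a w, h, one_mul])
    have e1 : leftMul b a (basisVec w) 1 = 0 := by
      rcases length_lt_or_gt_left b a w with h | h
      · rw [leftMul_of_lt h, basisVec_apply_one_of_ne hl]
      · rw [leftMul_of_gt h, Finsupp.add_apply, Finsupp.smul_apply, Finsupp.smul_apply,
          basisVec_apply_one_of_ne hl, basisVec_apply_one_of_ne hw1, smul_zero, smul_zero,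
          add_zero]
    have e2 : rightMul b a (basisVec w) 1 = 0 := by
      rcases length_lt_or_gt_right b a w with h | h
      · rw [rightMul_of_lt h, basisVec_apply_one_of_ne hr]
      · rw [rightMul_of_gt h, Finsupp.add_apply, Finsupp.smul_apply, Finsupp.smul_apply,
          basisVec_apply_one_of_ne hr, basisVec_apply_one_of_ne hw1, smul_zero, smul_zero,
          add_zero]
    rw [e1, e2]
  exact LinearMap.congr_fun key x

theorem leftMul_basisVec_one (a : b.support) :
    leftMul b a (basisVec 1) = rightMul b a (basisVec 1) := by
  have h1 : length b (1 : P.weylGroup) < length b (simpleRefl b a) := by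
    have := length_refl_mul_ne b 1 a
    rw [length_one, mul_one] at this
    rw [length_one]
    exact Nat.pos_of_ne_zero this
  rw [leftMul_of_lt (by rwa [mul_one]), rightMul_of_lt (by rwa [one_mul]), mul_one, one_mul]

/-- The functional `Λ` is a trace. -/
theorem Lam_mul_comm (g h : Hecke b) : Lam b (g * h) = Lam b (h * g) := by
  obtain ⟨g, hg⟩ := g
  change (g (h.1 (basisVec 1))) 1 = h.1 (g (basisVec 1)) 1
  induction hg using Algebra.adjoin_induction generalizing h with
  | mem x hx =>
    obtain ⟨a, rfl⟩ := hx
    -- Both sides become the `T_1` coefficient of `h(T_1)` multiplied by `T_s` on the right.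
    rw [leftMul_apply_one, leftMul_basisVec_one, hecke_rightMul_comm]
  | algebraMap r =>
    rw [Module.algebraMap_end_apply, Module.algebraMap_end_apply, map_smul]
  | add x y _ _ hx hy =>
    rw [LinearMap.add_apply, LinearMap.add_apply, map_add, Finsupp.add_apply, Finsupp.add_apply,
      hx, hy]
  | mul x y hx' hy' hx hy =>
    have h1 := hx (⟨y, hy'⟩ * h)
    have h2 := hy (h * ⟨x, hx'⟩)
    simp only [MulMemClass.coe_mul, Module.End.mul_apply] at h1 h2 ⊢
    rw [h1, h2]

end Trace

/-! ### The eigenvector `ψ_u` -/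

section Psi

variable {u : P.weylGroup} {a : b.support}

theorem psi_apply_one (u : P.weylGroup) [Fintype P.weylGroup]
    [DecidablePred (BruhatLE b u)] :
    (psi b u).1 (basisVec 1) = ∑ x : P.weylGroup with BruhatLE b u x, basisVec x := by
  rw [psi, AddSubmonoidClass.coe_finsetSum, LinearMap.sum_apply]
  simp only [TBasis_apply_one]
  refine Finset.sum_congr ?_ fun _ _ => rfl
  ext x; simp

/-- By lifting, the elements above `u` fall into pairs `{x, s x}`, and `T_s - q` kills each `T_x +
T_{sx}`. -/
theorem TSimple_mul_psi (hu : length b u < length b (simpleRefl b a * u)) :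
    TSimple b a * psi b u = q • psi b u := by
  classical
  have := Fintype.ofFinite P.weylGroup
  apply hecke_ext
  change leftMul b a ((psi b u).1 (basisVec 1)) = q • (psi b u).1 (basisVec 1)
  rw [psi_apply_one, map_sum, Finset.smul_sum]
  set F : P.weylGroup → P.weylGroup →₀ ℂ[T;T⁻¹] := fun x =>
    leftMul b a (basisVec x) - q • basisVec x with hF
  rw [← sub_eq_zero, ← Finset.sum_sub_distrib]
  refine Finset.sum_involution (fun x _ => simpleRefl b a * x) ?_ ?_ ?_ ?_
  · intro x _
    rcases length_lt_or_gt_left b a x with h | h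
    · rw [leftMul_of_lt h, leftMul_of_gt (by rwa [simpleRefl_mul_simpleRefl_mul]),
        simpleRefl_mul_simpleRefl_mul]
      module
    · rw [leftMul_of_gt h, leftMul_of_lt (by rwa [simpleRefl_mul_simpleRefl_mul]),
        simpleRefl_mul_simpleRefl_mul]
      module
  · intro x _ _ h
    exact length_refl_mul_ne b x a (by rw [← simpleRefl, h])
  · intro x hx
    simp only [Finset.mem_filter, Finset.mem_univ, true_and] at hx ⊢
    exact hx.simpleRefl_mul hu
  · intro x _
    simp

end Psi

end HeckeModule

/-! ### Deformed braid relations in an algebra with two quadratic generators -/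

section QuadraticAlgebra

variable {R A : Type*} [CommRing R] [Semiring A] [Algebra R A] {S T : A} {p q : R}

theorem braid_two (hb : S * T = T * S) (c₁ c₂ : R) :
    (S + c₁ • 1) * (T + c₂ • 1) = (T + c₂ • 1) * (S + c₁ • 1) := by
  simp only [mul_add, add_mul, smul_mul_assoc, mul_smul_comm, mul_one, one_mul, hb]
  module

/-- Reversing products while exchanging `S` and `T` interchanges the two sides. Words of even length
are fixed by this, as is the longest one, so only the coefficients of `S` and `T` impose a
condition, namely `h`. -/
theorem braid_three (hS : S * S = p • S + q • 1) (hT : T * T = p • T + q • 1)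
    (hb : S * (T * S) = T * (S * T)) {c₁ c₂ c₃ : R}
    (h : c₁ * c₂ + c₂ * c₃ + p * c₂ = c₁ * c₃) :
    (S + c₁ • 1) * (T + c₂ • 1) * (S + c₃ • 1) =
      (T + c₃ • 1) * (S + c₂ • 1) * (T + c₁ • 1) := by
  simp only [mul_add, add_mul, smul_mul_assoc, mul_smul_comm, mul_one, one_mul, mul_assoc, hb,
    hS, hT]
  match_scalars <;> first | ring1 | linear_combination h | linear_combination -h

theorem braid_four (hS : S * S = p • S + q • 1) (hT : T * T = p • T + q • 1)
    (hb : S * (T * (S * T)) = T * (S * (T * S))) {c₁ c₂ c₃ c₄ : R}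
    (h : c₁ * c₂ + c₂ * c₃ + c₃ * c₄ + p * (c₂ + c₃) = c₁ * c₄) :
    (S + c₁ • 1) * (T + c₂ • 1) * (S + c₃ • 1) * (T + c₄ • 1) =
      (T + c₄ • 1) * (S + c₃ • 1) * (T + c₂ • 1) * (S + c₁ • 1) := by
  simp only [mul_add, add_mul, smul_mul_assoc, mul_smul_comm, mul_one, one_mul, mul_assoc, hb,
    hS, hT]
  match_scalars <;> first | ring1 | linear_combination h | linear_combination -h

/-- As in `braid_four`, the two sides are reverses of each other, so the coefficients of palindromic
words agree automatically. The condition `h₁` comes from comparing `STST` and `TSTS`, and `h₃ + q *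
h₂` from `ST` and `TS`. -/
theorem braid_six (hS : S * S = p • S + q • 1) (hT : T * T = p • T + q • 1)
    (hb : S * (T * (S * (T * (S * T)))) = T * (S * (T * (S * (T * S)))))
    {c₁ c₂ c₃ c₄ c₅ c₆ : R}
    (h₁ : c₁ * c₂ + c₂ * c₃ + c₃ * c₄ + c₄ * c₅ + c₅ * c₆ + p * (c₂ + c₃ + c₄ + c₅) = c₁ * c₆)
    (h₂ : c₁ * c₃ + c₂ * c₄ + c₃ * c₅ + c₄ * c₆ + p * (c₃ + c₄) = c₁ * c₅ + c₂ * c₆)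
    (h₃ : c₁*c₂*c₃*c₄ + c₁*c₂*c₄*c₅ + c₁*c₂*c₄*p + c₁*c₂*c₅*c₆ + c₁*c₂*c₅*p + c₂*c₃*c₄*c₅ +
      c₂*c₃*c₄*p + c₂*c₃*c₅*c₆ + c₂*c₃*c₅*p + c₂*c₄*c₅*p + c₂*c₄*p*p + c₂*c₅*c₆*p +
      c₂*c₅*p*p + c₃*c₄*c₅*c₆ + c₃*c₄*c₅*p + c₃*c₅*c₆*p + c₃*c₅*p*p =
      c₁*c₂*c₃*c₆ + c₁*c₃*c₄*c₆ + c₁*c₃*c₆*p + c₁*c₄*c₅*c₆ + c₁*c₄*c₆*p) :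
    (S + c₁ • 1) * (T + c₂ • 1) * (S + c₃ • 1) * (T + c₄ • 1) * (S + c₅ • 1) * (T + c₆ • 1) =
      (T + c₆ • 1) * (S + c₅ • 1) * (T + c₄ • 1) * (S + c₃ • 1) * (T + c₂ • 1) *
        (S + c₁ • 1) := by
  simp only [mul_add, add_mul, smul_mul_assoc, mul_smul_comm, mul_one, one_mul, mul_assoc, hb,
    hS, hT]
  match_scalars <;> first
    | ring1
    | linear_combination h₁
    | linear_combination -h₁
    | linear_combination h₃ + q * h₂
    | linear_combination -h₃ - q * h₂

end QuadraticAlgebra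

/-- The coefficient `(q - 1) t / (1 - t)`. -/
def muCoeff (t : ℂ) : ℂ[T;T⁻¹] := (q - 1) * LaurentPolynomial.C (t / (1 - t))

/-! ### Rational identities over the positive roots of A2, B2 and G2 -/

section Coefficients

variable {x y : ℂ}

/-- The relation is homogeneous of degree two in the coefficients and `q - 1`. Dividing by `(q - 1)
^ 2` leaves an identity between the complex numbers `t / (1 - t)`, with `q - 1` replaced by `1`. The
B2 and G2 relations are treated in the same way. -/
theorem muCoeff_three (hx : x ≠ 1) (hxy : x * y ≠ 1) (hy : y ≠ 1) :
    muCoeff x * muCoeff (x * y) + muCoeff (x * y) * muCoeff y + (q - 1) * muCoeff (x * y) =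
      muCoeff x * muCoeff y := by
  have h1 := sub_ne_zero.mpr hx.symm
  have h2 := sub_ne_zero.mpr hxy.symm
  have h3 := sub_ne_zero.mpr hy.symm
  have key : x / (1 - x) * (x * y / (1 - x * y)) + x * y / (1 - x * y) * (y / (1 - y)) +
      x * y / (1 - x * y) = x / (1 - x) * (y / (1 - y)) := by
    field_simp
    ring
  have := congrArg LaurentPolynomial.C key
  simp only [map_add, map_mul] at this
  simp only [muCoeff]
  linear_combination (q - 1) ^ 2 * this

theorem muCoeff_four (hx : x ≠ 1) (h2 : x ^ 2 * y ≠ 1) (h3 : x * y ≠ 1) (hy : y ≠ 1) :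
    muCoeff x * muCoeff (x ^ 2 * y) + muCoeff (x ^ 2 * y) * muCoeff (x * y) +
      muCoeff (x * y) * muCoeff y + (q - 1) * (muCoeff (x ^ 2 * y) + muCoeff (x * y)) =
      muCoeff x * muCoeff y := by
  have e1 := sub_ne_zero.mpr hx.symm
  have e2 := sub_ne_zero.mpr h2.symm
  have e3 := sub_ne_zero.mpr h3.symm
  have e4 := sub_ne_zero.mpr hy.symm
  have key : x / (1 - x) * (x ^ 2 * y / (1 - x ^ 2 * y)) +
      x ^ 2 * y / (1 - x ^ 2 * y) * (x * y / (1 - x * y)) + x * y / (1 - x * y) * (y / (1 - y)) +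
      (x ^ 2 * y / (1 - x ^ 2 * y) + x * y / (1 - x * y)) = x / (1 - x) * (y / (1 - y)) := by
    field_simp
    ring
  have := congrArg LaurentPolynomial.C key
  simp only [map_add, map_mul] at this
  simp only [muCoeff]
  linear_combination (q - 1) ^ 2 * this

variable (hx : x ≠ 1) (h2 : x ^ 3 * y ≠ 1) (h3 : x ^ 2 * y ≠ 1) (h4 : x ^ 3 * y ^ 2 ≠ 1)
  (h5 : x * y ≠ 1) (hy : y ≠ 1)

include hx h2 h3 h4 h5 hy

theorem muCoeff_six_one :
    let p := q - 1
    let c₁ := muCoeff x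
    let c₂ := muCoeff (x ^ 3 * y)
    let c₃ := muCoeff (x ^ 2 * y)
    let c₄ := muCoeff (x ^ 3 * y ^ 2)
    let c₅ := muCoeff (x * y)
    let c₆ := muCoeff y
    c₁ * c₂ + c₂ * c₃ + c₃ * c₄ + c₄ * c₅ + c₅ * c₆ + p * (c₂ + c₃ + c₄ + c₅) =
      c₁ * c₆ := by
  intro p c₁ c₂ c₃ c₄ c₅ c₆
  have e1 := sub_ne_zero.mpr hx.symm
  have e2 := sub_ne_zero.mpr h2.symm
  have e3 := sub_ne_zero.mpr h3.symm
  have e4 := sub_ne_zero.mpr h4.symm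
  have e5 := sub_ne_zero.mpr h5.symm
  have e6 := sub_ne_zero.mpr hy.symm
  have key :
      let d₁ := x / (1 - x)
      let d₂ := x ^ 3 * y / (1 - (x ^ 3 * y))
      let d₃ := x ^ 2 * y / (1 - (x ^ 2 * y))
      let d₄ := x ^ 3 * y ^ 2 / (1 - (x ^ 3 * y ^ 2))
      let d₅ := x * y / (1 - (x * y))
      let d₆ := y / (1 - y)
      d₁ * d₂ + d₂ * d₃ + d₃ * d₄ + d₄ * d₅ + d₅ * d₆ + (d₂ + d₃ + d₄ + d₅) =
        d₁ * d₆ := by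
    dsimp only
    field_simp
    ring
  have := congrArg LaurentPolynomial.C key
  simp only [map_add, map_mul] at this
  simp only [c₁, c₂, c₃, c₄, c₅, c₆, p, muCoeff]
  linear_combination (q - 1) ^ 2 * this

theorem muCoeff_six_two :
    let p := q - 1
    let c₁ := muCoeff x
    let c₂ := muCoeff (x ^ 3 * y)
    let c₃ := muCoeff (x ^ 2 * y)
    let c₄ := muCoeff (x ^ 3 * y ^ 2)
    let c₅ := muCoeff (x * y)
    let c₆ := muCoeff y
    c₁ * c₃ + c₂ * c₄ + c₃ * c₅ + c₄ * c₆ + p * (c₃ + c₄) =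
      c₁ * c₅ + c₂ * c₆ := by
  intro p c₁ c₂ c₃ c₄ c₅ c₆
  have e1 := sub_ne_zero.mpr hx.symm
  have e2 := sub_ne_zero.mpr h2.symm
  have e3 := sub_ne_zero.mpr h3.symm
  have e4 := sub_ne_zero.mpr h4.symm
  have e5 := sub_ne_zero.mpr h5.symm
  have e6 := sub_ne_zero.mpr hy.symm
  have key :
      let d₁ := x / (1 - x)
      let d₂ := x ^ 3 * y / (1 - (x ^ 3 * y))
      let d₃ := x ^ 2 * y / (1 - (x ^ 2 * y))
      let d₄ := x ^ 3 * y ^ 2 / (1 - (x ^ 3 * y ^ 2))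
      let d₅ := x * y / (1 - (x * y))
      let d₆ := y / (1 - y)
      d₁ * d₃ + d₂ * d₄ + d₃ * d₅ + d₄ * d₆ + (d₃ + d₄) =
        d₁ * d₅ + d₂ * d₆ := by
    dsimp only
    field_simp
    ring
  have := congrArg LaurentPolynomial.C key
  simp only [map_add, map_mul] at this
  simp only [c₁, c₂, c₃, c₄, c₅, c₆, p, muCoeff]
  linear_combination (q - 1) ^ 2 * this

theorem muCoeff_six_three :
    let p := q - 1
    let c₁ := muCoeff x
    let c₂ := muCoeff (x ^ 3 * y)
    let c₃ := muCoeff (x ^ 2 * y)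
    let c₄ := muCoeff (x ^ 3 * y ^ 2)
    let c₅ := muCoeff (x * y)
    let c₆ := muCoeff y
    c₁ * c₂ * c₃ * c₄ + c₁ * c₂ * c₄ * c₅ + c₁ * c₂ * c₄ * p + c₁ * c₂ * c₅ * c₆ +
    c₁ * c₂ * c₅ * p + c₂ * c₃ * c₄ * c₅ + c₂ * c₃ * c₄ * p + c₂ * c₃ * c₅ * c₆ +
    c₂ * c₃ * c₅ * p + c₂ * c₄ * c₅ * p + c₂ * c₄ * p * p + c₂ * c₅ * c₆ * p +
    c₂ * c₅ * p * p + c₃ * c₄ * c₅ * c₆ + c₃ * c₄ * c₅ * p + c₃ * c₅ * c₆ * p +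
    c₃ * c₅ * p * p =
      c₁ * c₂ * c₃ * c₆ + c₁ * c₃ * c₄ * c₆ + c₁ * c₃ * c₆ * p + c₁ * c₄ * c₅ * c₆ +
        c₁ * c₄ * c₆ * p := by
  intro p c₁ c₂ c₃ c₄ c₅ c₆
  have e1 := sub_ne_zero.mpr hx.symm
  have e2 := sub_ne_zero.mpr h2.symm
  have e3 := sub_ne_zero.mpr h3.symm
  have e4 := sub_ne_zero.mpr h4.symm
  have e5 := sub_ne_zero.mpr h5.symm
  have e6 := sub_ne_zero.mpr hy.symm
  have key :
      let d₁ := x / (1 - x)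
      let d₂ := x ^ 3 * y / (1 - (x ^ 3 * y))
      let d₃ := x ^ 2 * y / (1 - (x ^ 2 * y))
      let d₄ := x ^ 3 * y ^ 2 / (1 - (x ^ 3 * y ^ 2))
      let d₅ := x * y / (1 - (x * y))
      let d₆ := y / (1 - y)
      d₁ * d₂ * d₃ * d₄ + d₁ * d₂ * d₄ * d₅ + d₁ * d₂ * d₄ + d₁ * d₂ * d₅ * d₆ +
      d₁ * d₂ * d₅ + d₂ * d₃ * d₄ * d₅ + d₂ * d₃ * d₄ + d₂ * d₃ * d₅ * d₆ +
      d₂ * d₃ * d₅ + d₂ * d₄ * d₅ + d₂ * d₄ + d₂ * d₅ * d₆ +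
      d₂ * d₅ + d₃ * d₄ * d₅ * d₆ + d₃ * d₄ * d₅ + d₃ * d₅ * d₆ +
      d₃ * d₅ =
        d₁ * d₂ * d₃ * d₆ + d₁ * d₃ * d₄ * d₆ + d₁ * d₃ * d₆ + d₁ * d₄ * d₅ * d₆ +
          d₁ * d₄ * d₆ := by
    dsimp only
    field_simp
    ring
  have := congrArg LaurentPolynomial.C key
  simp only [map_add, map_mul] at this
  simp only [c₁, c₂, c₃, c₄, c₅, c₆, p, muCoeff]
  -- The third relation is homogeneous of degree four instead of two.
  linear_combination (q - 1) ^ 4 * this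

end Coefficients

/-! ### Pairs of simple roots and the elements `μ_z` -/

section RankTwo

variable {ι X Y : Type*} [AddCommGroup X] [AddCommGroup Y] {P : RootPairing ι ℤ X Y}
  {b : P.Base} {a c : b.support}

theorem IsRegular.torusAct {z : Torus X} (hz : IsRegular P z) (w : P.weylGroup) :
    IsRegular P (torusAct w z) := fun i => by
  have := hz (rootPerm w⁻¹ i)
  rwa [root_rootPerm] at this

theorem torusAct_apply (w : P.weylGroup) (z : Torus X) (x : X) :
    torusAct w z x = z (w⁻¹ • x) := rfl

theorem torusAct_mul (w w' : P.weylGroup) (z : Torus X) :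
    torusAct (w * w') z = torusAct w (torusAct w' z) := by
  ext x
  simp only [torusAct_apply, mul_inv_rev, mul_smul]

theorem muWord_append (z : Torus X) (L M : List b.support) :
    muWord b z (L ++ M) = muWord b z M * muWord b (torusAct (wordProd b M) z) L := by
  induction L with
  | nil => simp [muWord]
  | cons a L ih =>
    rw [List.cons_append, muWord, ih, muWord, wordProd_append, torusAct_mul, mul_assoc]

/-- Taking out `q⁻¹` puts the factors of `μ_z` in the form `T_s + c` to which the deformed braid
relations apply. -/
theorem muSimple_torusAct (z : Torus X) (w : P.weylGroup) (a : b.support) :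
    muSimple b (torusAct w z) a = qInv • (TSimple b a +
      muCoeff (z (w⁻¹ • P.root a)) • 1) := by
  rw [muCoeff, muSimple, smul_add, smul_smul, Algebra.algebraMap_eq_smul_one, torusAct_apply]
  congr 2
  linear_combination
    -(LaurentPolynomial.C (z (w⁻¹ • P.root a) / (1 - z (w⁻¹ • P.root a)))) * q_mul_qInv

@[simp] theorem simpleRefl_inv (a : b.support) : (simpleRefl b a)⁻¹ = simpleRefl b a :=
  refl_inv _

/-- The combination `m α + n γ` of two simple roots `α` and `γ`. -/
def rootComb (a c : b.support) (m n : ℤ) : X := m • P.root a + n • P.root c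

theorem weylGroup_mul_smul (w w' : P.weylGroup) (x : X) : (w * w') • x = w • w' • x :=
  mul_smul w w' x

theorem root_left_eq (a c : b.support) : P.root a = rootComb a c 1 0 := by simp [rootComb]

theorem root_right_eq (a c : b.support) : P.root c = rootComb a c 0 1 := by simp [rootComb]

theorem simpleRefl_left_smul {k : ℤ} (h : P.pairing c a = -k) (m n : ℤ) :
    simpleRefl b a • rootComb a c m n = rootComb a c (k * n - m) n := by
  rw [simpleRefl, refl_smul, rootComb, rootComb, map_add, map_zsmul, map_zsmul,
    reflection_apply_self, reflection_apply_root, h]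
  module

theorem simpleRefl_right_smul {l : ℤ} (h : P.pairing a c = -l) (m n : ℤ) :
    simpleRefl b c • rootComb a c m n = rootComb a c m (l * m - n) := by
  rw [simpleRefl, refl_smul, rootComb, rootComb, map_add, map_zsmul, map_zsmul,
    reflection_apply_self, reflection_apply_root, h]
  module

theorem torus_rootComb (z : Torus X) (m n : ℤ) :
    z (rootComb a c m n) = z (P.root a) ^ m * z (P.root c) ^ n := by
  rw [rootComb, AddChar.map_add_eq_mul, AddChar.map_zsmul_eq_zpow, AddChar.map_zsmul_eq_zpow]

theorem simpleRefl_smul (a : b.support) (x : X) :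
    simpleRefl b a • x = x - P.toLinearMap x (P.coroot a) • P.root a := by
  rw [simpleRefl, refl_smul, reflection_apply]
  rfl

theorem height_neg_of_not_isPos {i : ι} (h : ¬ b.IsPos i) : b.height i < 0 :=
  lt_of_le_of_ne (not_lt.mp h) (b.height_ne_zero i)

/-- Height is additive and negative on the images of both simple roots. Thus an element with left
descents `a` and `c` keeps admitting left descents while the alternating word is stripped off. -/
theorem not_isPos_of_root_eq_comb {w : P.weylGroup} (ha : ¬ b.IsPos (rootPerm w⁻¹ a))
    (hc : ¬ b.IsPos (rootPerm w⁻¹ c)) {i : ι} (m n : ℕ)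
    (h : P.root i = w⁻¹ • rootComb a c m n) : ¬ b.IsPos i := by
  replace ha := height_neg_of_not_isPos ha
  replace hc := height_neg_of_not_isPos hc
  obtain ⟨f, -, -, hf⟩ := b.exists_root_eq_sum_int (rootPerm w⁻¹ a)
  obtain ⟨g, -, -, hg⟩ := b.exists_root_eq_sum_int (rootPerm w⁻¹ c)
  have hi : P.root i = ∑ j ∈ b.support, ((m : ℤ) • f + (n : ℤ) • g) j • P.root j := by
    simp_rw [Pi.add_apply, Pi.smul_apply, add_smul, smul_assoc, Finset.sum_add_distrib,
      ← Finset.smul_sum]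
    rw [← hf, ← hg, h, rootComb, smul_add, smul_comm w⁻¹ (m : ℤ), smul_comm w⁻¹ (n : ℤ), root_rootPerm, root_rootPerm]
  rw [Base.height_eq_sum hf] at ha
  rw [Base.height_eq_sum hg] at hc
  rw [Base.isPos_iff, Base.height_eq_sum hi]
  simp_rw [Pi.add_apply, Pi.smul_apply, Finset.sum_add_distrib, smul_eq_mul, ← Finset.mul_sum]
  nlinarith

theorem not_isPos_of_root_eq_neg {i : ι} (h : P.root i = -P.root a) : ¬ b.IsPos i := by
  rw [← root_neg] at h
  rw [P.root.injective h, isPos_neg_iff]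
  exact not_not.mpr (isPos_simple b a)

theorem length_strip_nil (w : P.weylGroup) :
    length b ((wordProd b [])⁻¹ * w) + ([] : List b.support).length = length b w := by
  simp

/-- Two words with the same product, one starting with `a` and the other one with `c`, for which
the elements `μ_z` agree, and such that each `w` with left descents `a` and `c` has reduced words
starting with them. -/
structure BraidPair (b : P.Base) (a c : b.support) (A B : List b.support) : Prop where
  wordProd_eq : wordProd b (a :: A) = wordProd b (c :: B)
  length_eq : A.length = B.length
  muWord_eq : ∀ z : Torus X, IsRegular P z → muWord b z (a :: A) = muWord b z (c :: B)
  length_strip : ∀ w : P.weylGroup, ¬ b.IsPos (rootPerm w⁻¹ a) → ¬ b.IsPos (rootPerm w⁻¹ c) →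
    length b ((wordProd b (a :: A))⁻¹ * w) + (a :: A).length = length b w

theorem BraidPair.symm {A B : List b.support} (h : BraidPair b a c A B) : BraidPair b c a B A where
  wordProd_eq := h.wordProd_eq.symm
  length_eq := h.length_eq.symm
  muWord_eq z hz := (h.muWord_eq z hz).symm
  length_strip w hc ha := by
    have := h.length_strip w ha hc
    rw [← h.wordProd_eq, List.length_cons, ← h.length_eq]
    exact this

variable [Finite ι] [P.IsReduced]

theorem length_simpleRefl_mul_add_one {w : P.weylGroup} (h : ¬ b.IsPos (rootPerm w⁻¹ a)) :
    length b (simpleRefl b a * w) + 1 = length b w := by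
  have h1 := (length_simpleRefl_mul_lt_iff b (w := w) (a := a)).mpr h
  have h2 := length_le_simpleRefl_mul b w a
  omega

theorem length_strip_cons {w : P.weylGroup} {A : List b.support}
    (h : ¬ b.IsPos (rootPerm w⁻¹ a))
    (h' : length b ((wordProd b A)⁻¹ * (simpleRefl b a * w)) + A.length =
      length b (simpleRefl b a * w)) :
    length b ((wordProd b (a :: A))⁻¹ * w) + (a :: A).length = length b w := by
  rw [wordProd_cons, mul_inv_rev, simpleRefl_inv, List.length_cons, ← add_assoc, mul_assoc, h']
  exact length_simpleRefl_mul_add_one h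

end RankTwo

/-! ### Braid relations in types A1 × A1, A2, B2 and G2 -/

section BraidRelations

variable {ι X Y : Type*} [AddCommGroup X] [AddCommGroup Y] {P : RootPairing ι ℤ X Y}
  {b : P.Base} {a c : b.support} [Finite ι] [P.IsReduced]

theorem braidPair_two (hca : P.pairing c a = 0) (hac : P.pairing a c = 0) :
    BraidPair b a c [c] [a] := by
  have hA := simpleRefl_left_smul (k := 0) (by rw [hca, neg_zero])
  have hC := simpleRefl_right_smul (l := 0) (by rw [hac, neg_zero])
  have hstrip : ∀ w : P.weylGroup, ¬ b.IsPos (rootPerm w⁻¹ a) → ¬ b.IsPos (rootPerm w⁻¹ c) →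
      length b ((wordProd b [a, c])⁻¹ * w) + [a, c].length = length b w := by
    intro w ha hc
    refine length_strip_cons ha (length_strip_cons ?_ (length_strip_nil _))
    · apply not_isPos_of_root_eq_comb ha hc 0 1
      simp [root_rootPerm, mul_smul, root_right_eq a c, hA]
  have hprod : wordProd b [a, c] = wordProd b [c, a] := by
    refine weylGroup_ext fun x => ?_
    simp only [wordProd_cons, wordProd_nil, mul_one, mul_smul, simpleRefl_smul, map_sub,
      LinearMap.sub_apply, map_smul, LinearMap.smul_apply, root_coroot_eq_pairing,
      hca, hac, smul_eq_mul]
    module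
  -- Stripping the word from its own product leaves `1`, so `hstrip` computes the length exactly. It
  -- applies because the inverse of this product makes both simple roots negative. The other types
  -- use the same device.
  have hlen : length b (wordProd b [a, c]) = 2 := by
    have := hstrip (wordProd b [a, c])
      (not_isPos_of_root_eq_neg (a := a) (by
        simp [root_rootPerm, mul_smul, root_left_eq a c, hA, hC]
        simp [rootComb]))
      (not_isPos_of_root_eq_neg (a := c) (by
        simp [root_rootPerm, mul_smul, root_right_eq a c, hA, hC]
        simp [rootComb]))
    rw [inv_mul_cancel, length_one] at this
    simpa using this.symm
  refine ⟨hprod, rfl, fun z hz => ?_, hstrip⟩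
  have hT := prod_TSimple_eq hlen (by rw [← hprod, hlen]; rfl) hprod
  simp only [List.map_cons, List.map_nil, List.prod_cons, List.prod_nil, mul_one] at hT
  simp only [muWord, one_mul, muSimple_torusAct, wordProd_cons, wordProd_nil, mul_one,
    simpleRefl_inv, inv_one, smul_mul_assoc, mul_smul_comm]
  simp only [one_smul, root_right_eq a c, root_left_eq a c, hA, hC,
    Int.reduceMul, Int.reduceSub]
  simp only [torus_rootComb, zpow_ofNat, pow_one, pow_zero, one_mul, mul_one]
  rw [braid_two hT]

theorem braidPair_three (hca : P.pairing c a = -1) (hac : P.pairing a c = -1) :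
    BraidPair b a c [c, a] [a, c] := by
  have hA := simpleRefl_left_smul hca
  have hC := simpleRefl_right_smul hac
  have hstrip : ∀ w : P.weylGroup, ¬ b.IsPos (rootPerm w⁻¹ a) → ¬ b.IsPos (rootPerm w⁻¹ c) →
      length b ((wordProd b [a, c, a])⁻¹ * w) + [a, c, a].length = length b w := by
    intro w ha hc
    refine length_strip_cons ha (length_strip_cons ?_ (length_strip_cons ?_ (length_strip_nil _)))
    · apply not_isPos_of_root_eq_comb ha hc 1 1
      simp [root_rootPerm, mul_smul, root_right_eq a c, hA]
    · apply not_isPos_of_root_eq_comb ha hc 0 1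
      simp [root_rootPerm, mul_smul, root_left_eq a c, hA, hC]
  have hprod : wordProd b [a, c, a] = wordProd b [c, a, c] := by
    refine weylGroup_ext fun x => ?_
    simp only [wordProd_cons, wordProd_nil, mul_one, mul_smul, simpleRefl_smul, map_sub,
      LinearMap.sub_apply, map_smul, LinearMap.smul_apply, root_coroot_eq_pairing,
      pairing_same, hca, hac, smul_eq_mul]
    module
  have hlen : length b (wordProd b [a, c, a]) = 3 := by
    have := hstrip (wordProd b [a, c, a])
      (not_isPos_of_root_eq_neg (a := c) (by
        simp [root_rootPerm, mul_smul, root_left_eq a c, hA, hC]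
        simp [rootComb]))
      (not_isPos_of_root_eq_neg (a := a) (by
        simp [root_rootPerm, mul_smul, root_right_eq a c, hA, hC]
        simp [rootComb]))
    rw [inv_mul_cancel, length_one] at this
    simpa using this.symm
  refine ⟨hprod, rfl, fun z hz => ?_, hstrip⟩
  have hT := prod_TSimple_eq hlen (by rw [← hprod, hlen]; rfl) hprod
  simp only [List.map_cons, List.map_nil, List.prod_cons, List.prod_nil, mul_one] at hT
  have hreg (w : P.weylGroup) (i : ι) : z (w • P.root i) ≠ 1 := by
    rw [← root_rootPerm]; exact hz _
  -- The roots met along the alternating word are `α`, `α + γ`, `γ`; regularity of `z` keeps all the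
  -- denominators nonzero.
  have h1 := hreg 1 a
  have h2 := hreg (simpleRefl b a) c
  have h3 := hreg (simpleRefl b a * simpleRefl b c) a
  simp only [one_smul, weylGroup_mul_smul, root_right_eq a c, root_left_eq a c, hA, hC,
    Int.reduceMul, Int.reduceSub] at h1 h2 h3
  simp only [torus_rootComb, zpow_ofNat, pow_one, pow_zero, one_mul, mul_one] at h1 h2 h3
  simp only [muWord, one_mul, muSimple_torusAct, wordProd_cons, wordProd_nil, mul_one,
    mul_inv_rev, simpleRefl_inv, inv_one, smul_mul_assoc, mul_smul_comm]
  simp only [one_smul, weylGroup_mul_smul, root_right_eq a c, root_left_eq a c, hA, hC,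
    Int.reduceMul, Int.reduceSub]
  simp only [torus_rootComb, zpow_ofNat, pow_one, pow_zero, one_mul, mul_one]
  rw [braid_three (TSimple_mul_self a) (TSimple_mul_self c) hT (muCoeff_three h1 h2 h3)]

/-- Here `a` is the short root, and the positive roots are met in the order `α`, `2α + γ`, `α + γ`,
`γ`. -/
theorem braidPair_four (hca : P.pairing c a = -2) (hac : P.pairing a c = -1) :
    BraidPair b a c [c, a, c] [a, c, a] := by
  have hA := simpleRefl_left_smul hca
  have hC := simpleRefl_right_smul hac
  have hstrip : ∀ w : P.weylGroup, ¬ b.IsPos (rootPerm w⁻¹ a) → ¬ b.IsPos (rootPerm w⁻¹ c) →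
      length b ((wordProd b [a, c, a, c])⁻¹ * w) + [a, c, a, c].length = length b w := by
    intro w ha hc
    refine length_strip_cons ha (length_strip_cons ?_ (length_strip_cons ?_ (length_strip_cons ?_ (length_strip_nil _))))
    · apply not_isPos_of_root_eq_comb ha hc 2 1
      simp [root_rootPerm, mul_smul, root_right_eq a c, hA]
    · apply not_isPos_of_root_eq_comb ha hc 1 1
      simp [root_rootPerm, mul_smul, root_left_eq a c, hA, hC]
    · apply not_isPos_of_root_eq_comb ha hc 0 1
      simp [root_rootPerm, mul_smul, root_right_eq a c, hA, hC]
  have hprod : wordProd b [a, c, a, c] = wordProd b [c, a, c, a] := by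
    refine weylGroup_ext fun x => ?_
    simp only [wordProd_cons, wordProd_nil, mul_one, mul_smul, simpleRefl_smul, map_sub,
      LinearMap.sub_apply, map_smul, LinearMap.smul_apply, root_coroot_eq_pairing,
      pairing_same, hca, hac, smul_eq_mul]
    module
  have hlen : length b (wordProd b [a, c, a, c]) = 4 := by
    have := hstrip (wordProd b [a, c, a, c])
      (not_isPos_of_root_eq_neg (a := a) (by
        simp [root_rootPerm, mul_smul, root_left_eq a c, hA, hC]
        simp [rootComb]))
      (not_isPos_of_root_eq_neg (a := c) (by
        simp [root_rootPerm, mul_smul, root_right_eq a c, hA, hC]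
        simp [rootComb]))
    rw [inv_mul_cancel, length_one] at this
    simpa using this.symm
  refine ⟨hprod, rfl, fun z hz => ?_, hstrip⟩
  have hT := prod_TSimple_eq hlen (by rw [← hprod, hlen]; rfl) hprod
  simp only [List.map_cons, List.map_nil, List.prod_cons, List.prod_nil, mul_one] at hT
  have hreg (w : P.weylGroup) (i : ι) : z (w • P.root i) ≠ 1 := by
    rw [← root_rootPerm]; exact hz _
  have h1 := hreg 1 a
  have h2 := hreg (simpleRefl b a) c
  have h3 := hreg (simpleRefl b a * simpleRefl b c) a
  have h4 := hreg (simpleRefl b a * simpleRefl b c * simpleRefl b a) c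
  simp only [one_smul, weylGroup_mul_smul, root_right_eq a c, root_left_eq a c, hA, hC,
    Int.reduceMul, Int.reduceSub] at h1 h2 h3 h4
  simp only [torus_rootComb, zpow_ofNat, pow_one, pow_zero, one_mul, mul_one] at h1 h2 h3 h4
  simp only [muWord, one_mul, muSimple_torusAct, wordProd_cons, wordProd_nil, mul_one,
    mul_inv_rev, simpleRefl_inv, inv_one, smul_mul_assoc, mul_smul_comm]
  simp only [one_smul, weylGroup_mul_smul, root_right_eq a c, root_left_eq a c, hA, hC,
    Int.reduceMul, Int.reduceSub]
  simp only [torus_rootComb, zpow_ofNat, pow_one, pow_zero, one_mul, mul_one]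
  rw [braid_four (TSimple_mul_self a) (TSimple_mul_self c) hT (muCoeff_four h1 h2 h3 h4)]

/-- Again `a` is short; the order of the positive roots is `α`, `3α + γ`, `2α + γ`, `3α + 2γ`, `α +
γ`, `γ`. -/
theorem braidPair_six (hca : P.pairing c a = -3) (hac : P.pairing a c = -1) :
    BraidPair b a c [c, a, c, a, c] [a, c, a, c, a] := by
  have hA := simpleRefl_left_smul hca
  have hC := simpleRefl_right_smul hac
  have hstrip : ∀ w : P.weylGroup, ¬ b.IsPos (rootPerm w⁻¹ a) → ¬ b.IsPos (rootPerm w⁻¹ c) →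
      length b ((wordProd b [a, c, a, c, a, c])⁻¹ * w) + [a, c, a, c, a, c].length = length b w := by
    intro w ha hc
    refine length_strip_cons ha (length_strip_cons ?_ (length_strip_cons ?_ (length_strip_cons ?_ (length_strip_cons ?_ (length_strip_cons ?_ (length_strip_nil _))))))
    · apply not_isPos_of_root_eq_comb ha hc 3 1
      simp [root_rootPerm, mul_smul, root_right_eq a c, hA]
    · apply not_isPos_of_root_eq_comb ha hc 2 1
      simp [root_rootPerm, mul_smul, root_left_eq a c, hA, hC]
    · apply not_isPos_of_root_eq_comb ha hc 3 2
      simp [root_rootPerm, mul_smul, root_right_eq a c, hA, hC]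
    · apply not_isPos_of_root_eq_comb ha hc 1 1
      simp [root_rootPerm, mul_smul, root_left_eq a c, hA, hC]
    · apply not_isPos_of_root_eq_comb ha hc 0 1
      simp [root_rootPerm, mul_smul, root_right_eq a c, hA, hC]
  have hprod : wordProd b [a, c, a, c, a, c] = wordProd b [c, a, c, a, c, a] := by
    refine weylGroup_ext fun x => ?_
    simp only [wordProd_cons, wordProd_nil, mul_one, mul_smul, simpleRefl_smul, map_sub,
      LinearMap.sub_apply, map_smul, LinearMap.smul_apply, root_coroot_eq_pairing,
      pairing_same, hca, hac, smul_eq_mul]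
    module
  have hlen : length b (wordProd b [a, c, a, c, a, c]) = 6 := by
    have := hstrip (wordProd b [a, c, a, c, a, c])
      (not_isPos_of_root_eq_neg (a := a) (by
        simp [root_rootPerm, mul_smul, root_left_eq a c, hA, hC]
        simp [rootComb]))
      (not_isPos_of_root_eq_neg (a := c) (by
        simp [root_rootPerm, mul_smul, root_right_eq a c, hA, hC]
        simp [rootComb]))
    rw [inv_mul_cancel, length_one] at this
    simpa using this.symm
  refine ⟨hprod, rfl, fun z hz => ?_, hstrip⟩
  have hT := prod_TSimple_eq hlen (by rw [← hprod, hlen]; rfl) hprod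
  simp only [List.map_cons, List.map_nil, List.prod_cons, List.prod_nil, mul_one] at hT
  have hreg (w : P.weylGroup) (i : ι) : z (w • P.root i) ≠ 1 := by
    rw [← root_rootPerm]; exact hz _
  have h1 := hreg 1 a
  have h2 := hreg (simpleRefl b a) c
  have h3 := hreg (simpleRefl b a * simpleRefl b c) a
  have h4 := hreg (simpleRefl b a * simpleRefl b c * simpleRefl b a) c
  have h5 := hreg (simpleRefl b a * simpleRefl b c * simpleRefl b a * simpleRefl b c) a
  have h6 := hreg (simpleRefl b a * simpleRefl b c * simpleRefl b a * simpleRefl b c * simpleRefl b a) c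
  simp only [one_smul, weylGroup_mul_smul, root_right_eq a c, root_left_eq a c, hA, hC,
    Int.reduceMul, Int.reduceSub] at h1 h2 h3 h4 h5 h6
  simp only [torus_rootComb, zpow_ofNat, pow_one, pow_zero, one_mul, mul_one] at h1 h2 h3 h4 h5 h6
  simp only [muWord, one_mul, muSimple_torusAct, wordProd_cons, wordProd_nil, mul_one,
    mul_inv_rev, simpleRefl_inv, inv_one, smul_mul_assoc, mul_smul_comm]
  simp only [one_smul, weylGroup_mul_smul, root_right_eq a c, root_left_eq a c, hA, hC,
    Int.reduceMul, Int.reduceSub]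
  simp only [torus_rootComb, zpow_ofNat, pow_one, pow_zero, one_mul, mul_one]
  rw [braid_six (TSimple_mul_self a) (TSimple_mul_self c) hT
    (muCoeff_six_one h1 h2 h3 h4 h5 h6)
    (muCoeff_six_two h1 h2 h3 h4 h5 h6)
    (muCoeff_six_three h1 h2 h3 h4 h5 h6)]

end BraidRelations

/-! ### Independence of the reduced word -/

section WordIndependence

variable {ι X Y : Type*} [AddCommGroup X] [AddCommGroup Y] {P : RootPairing ι ℤ X Y}
  [Finite ι] [P.IsReduced] {b : P.Base} {a c : b.support}

theorem exists_braidPair (hne : a ≠ c) : ∃ A B, BraidPair b a c A B := by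
  have hne' : (a : ι) ≠ c := fun h => hne (Subtype.ext h)
  have hmem := P.pairingIn_pairingIn_mem_set_of_isCrystal_of_isRed' (a : ι) (c : ι)
    (fun h => hne' (P.root.injective h)) (b.root_ne_neg_of_ne a.2 c.2 hne')
  have h1 := b.pairingIn_le_zero_of_ne hne' a.2 c.2
  have h2 := b.pairingIn_le_zero_of_ne hne'.symm c.2 a.2
  have e1 : P.pairingIn ℤ a c = P.pairing a c := P.algebraMap_pairingIn ℤ a c
  have e2 : P.pairingIn ℤ c a = P.pairing c a := P.algebraMap_pairingIn ℤ c a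
  rw [e1, e2] at hmem
  rw [e1] at h1
  rw [e2] at h2
  simp only [Set.mem_insert_iff, Set.mem_singleton_iff, Prod.mk.injEq] at hmem
  -- Distinct simple roots have nonpositive pairings, which leaves the four rank-two types, with
  -- either root short in B2 and G2.
  rcases hmem with h | h | h | h | h | h | h | h | h | h | h <;> obtain ⟨h3, h4⟩ := h
  · exact ⟨_, _, braidPair_two h4 h3⟩
  · omega
  · exact ⟨_, _, braidPair_three h4 h3⟩
  · omega
  · omega
  · exact ⟨_, _, braidPair_four h4 h3⟩
  · exact ⟨_, _, (braidPair_four h3 h4).symm⟩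
  · omega
  · omega
  · exact ⟨_, _, braidPair_six h4 h3⟩
  · exact ⟨_, _, (braidPair_six h3 h4).symm⟩

/-- For regular `z`, the element `μ_z` computed along a reduced word depends only on the product
of the word. -/
theorem muWord_eq_of_reduced {z : Torus X} (hz : IsRegular P z) {L M : List b.support}
    (hL : length b (wordProd b L) = L.length) (hM : length b (wordProd b M) = M.length)
    (h : wordProd b L = wordProd b M) : muWord b z L = muWord b z M := by
  induction hn : L.length using Nat.strong_induction_on generalizing L M with
  | _ n ih =>
    subst hn
    have hlen : L.length = M.length := by rw [← hL, h, hM]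
    rcases L with _ | ⟨a, L⟩
    · rw [List.eq_nil_of_length_eq_zero hlen.symm]
    rcases M with _ | ⟨c, M⟩
    · simp at hlen
    have hL' := wordProd_cons_reduced hL
    have hM' := wordProd_cons_reduced hM
    by_cases hac : a = c
    · subst hac
      have h' : wordProd b L = wordProd b M := by simpa using h
      rw [muWord, muWord, ih L.length (by simp) hL'.1 hM'.1 h' rfl, h']
    -- Both `a` and `c` are left descents of `w`, so `w` has reduced words `a :: A ++ N` and `c :: B
    -- ++ N` with a common end. Induction on the tails links each given word to the one with the
    -- same first letter, and the braid relation links these two.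
    obtain ⟨A, B, hAB⟩ := exists_braidPair hac
    set w := wordProd b (a :: L) with hw
    have hwL : simpleRefl b a * w = wordProd b L := by simp [hw]
    have hwM : simpleRefl b c * w = wordProd b M := by simp [h]
    have ha : ¬ b.IsPos (rootPerm w⁻¹ a) := by
      rw [← length_simpleRefl_mul_lt_iff, hwL, hL'.1, hL]; simp
    have hc : ¬ b.IsPos (rootPerm w⁻¹ c) := by
      rw [← length_simpleRefl_mul_lt_iff, hwM, hM'.1, h, hM]; simp
    have hstrip := hAB.length_strip w ha hc
    set w' := (wordProd b (a :: A))⁻¹ * w with hw'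
    set N := reducedWord b w' with hN
    have hNw : wordProd b N = w' := wordProd_reducedWord b w'
    have hNl : N.length = length b w' := length_reducedWord b w'
    have eA : wordProd b (a :: (A ++ N)) = w := by
      rw [← List.cons_append, wordProd_append, hNw, hw', mul_inv_cancel_left]
    have eB : wordProd b (c :: (B ++ N)) = w := by
      rw [← List.cons_append, wordProd_append, hNw, hw', hAB.wordProd_eq, mul_inv_cancel_left]
    have lA : length b (wordProd b (a :: (A ++ N))) = (a :: (A ++ N)).length := by
      rw [eA, ← hstrip]; simp [hNl]; omega
    have lB : length b (wordProd b (c :: (B ++ N))) = (c :: (B ++ N)).length := by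
      rw [eB, ← hstrip]; simp [hNl, hAB.length_eq]; omega
    have pA : wordProd b L = wordProd b (A ++ N) := by
      rw [← hwL, ← eA]; simp
    have pB : wordProd b M = wordProd b (B ++ N) := by
      rw [← hwM, ← eB]; simp
    calc muWord b z (a :: L) = muWord b z (a :: (A ++ N)) := by
          rw [muWord, muWord, ih L.length (by simp) hL'.1 (wordProd_cons_reduced lA).1 pA rfl, pA]
      _ = muWord b z N * muWord b (torusAct (wordProd b N) z) (a :: A) := by
          rw [← List.cons_append, muWord_append]
      _ = muWord b z N * muWord b (torusAct (wordProd b N) z) (c :: B) := by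
          rw [hAB.muWord_eq _ (hz.torusAct _)]
      _ = muWord b z (c :: (B ++ N)) := by
          rw [← List.cons_append, muWord_append]
      _ = muWord b z (c :: M) := by
          have hlen' : M.length < (a :: L).length := by rw [hlen]; simp
          rw [muWord, muWord, ih M.length hlen' hM'.1 (wordProd_cons_reduced lB).1 pB rfl, pB]

/-- Prefixing `a` to a reduced word of `s v` gives a reduced word of `v`, by which the chosen one
may be replaced. -/
theorem mu_eq_mul_muSimple {z : Torus X} (hz : IsRegular P z) {v : P.weylGroup}
    (hv : length b (simpleRefl b a * v) < length b v) :
    mu b z v = mu b z (simpleRefl b a * v) *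
      muSimple b (torusAct (simpleRefl b a * v) z) a := by
  have hword : wordProd b (a :: reducedWord b (simpleRefl b a * v)) = v := by
    rw [wordProd_cons, wordProd_reducedWord, simpleRefl_mul_simpleRefl_mul]
  have h1 := length_le_simpleRefl_mul b v a
  rw [mu, muWord_eq_of_reduced (M := a :: reducedWord b (simpleRefl b a * v)) hz, muWord,
    wordProd_reducedWord, mu]
  · rw [wordProd_reducedWord, length_reducedWord]
  · rw [hword, List.length_cons, length_reducedWord]; omega
  · rw [hword, wordProd_reducedWord]

/-! ### The recursion for `m` -/

omit [Finite ι] [P.IsReduced] in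
theorem Lam_smul (r : ℂ[T;T⁻¹]) (h : Hecke b) : Lam b (r • h) = r * Lam b h := rfl

theorem muSimple_mul_psi {u : P.weylGroup} (z : Torus X)
    (hu : length b u < length b (simpleRefl b a * u)) (hz : z (P.root a) ≠ 1) :
    muSimple b z a * psi b u = (LaurentPolynomial.C (1 - z (P.root a))⁻¹ *
      (1 - qInv * LaurentPolynomial.C (z (P.root a)))) • psi b u := by
  have hC : LaurentPolynomial.C (1 - z (P.root a))⁻¹ *
      (1 - LaurentPolynomial.C (z (P.root a))) = (1 : ℂ[T;T⁻¹]) := by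
    rw [← map_one LaurentPolynomial.C, ← map_sub, ← map_mul,
      inv_mul_cancel₀ (sub_ne_zero.mpr hz.symm)]
  rw [muSimple, add_mul, smul_mul_assoc, TSimple_mul_psi hu, Algebra.algebraMap_eq_smul_one,
    smul_mul_assoc, one_mul, smul_smul, ← add_smul, div_eq_mul_inv, map_mul]
  congr 1
  linear_combination q_mul_qInv - hC

/-- The trace property moves the last factor of `μ_z(v)` to the left of `ψ_u`, which is an
eigenvector for it. The exponent is `(s v)⁻¹ α = v⁻¹ s α = -v⁻¹ α`. -/
theorem m_eq_mul {u v : P.weylGroup} {z : Torus X} (hz : IsRegular P z)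
    (hv : length b (simpleRefl b a * v) < length b v)
    (hu : length b u < length b (simpleRefl b a * u)) :
    m b u v z = LaurentPolynomial.C (1 - z (-(v⁻¹ • P.root a)))⁻¹ *
      (1 - qInv * LaurentPolynomial.C (z (-(v⁻¹ • P.root a)))) *
        m b u (simpleRefl b a * v) z := by
  have hroot : torusAct (simpleRefl b a * v) z (P.root a) = z (-(v⁻¹ • P.root a)) := by
    rw [torusAct_apply, mul_inv_rev, simpleRefl_inv, mul_smul]
    congr 1
    rw [← smul_neg, simpleRefl, refl_smul, reflection_apply_self]
  rw [m, mu_eq_mul_muSimple hz hv, ← mul_assoc, Lam_mul_comm, ← mul_assoc,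
    muSimple_mul_psi _ hu (hz.torusAct _ a), smul_mul_assoc, Lam_smul, hroot, m]

theorem bar_qInv : bar qInv = q := by
  rw [bar, qInv, q, LaurentPolynomial.invert_T, neg_neg]

end WordIndependence

end CasselmanBasis

end

open CasselmanBasis in
theorem mainTheorem6 {ι X Y : Type*} [Finite ι] [AddCommGroup X] [AddCommGroup Y]
    (P : RootPairing ι ℤ X Y) [P.IsReduced] (b : P.Base)
    (u v : P.weylGroup) (a : b.support)
    (huv : BruhatLT b u v)
    (hv : BruhatLT b (simpleRefl b a * v) v)
    (hu : BruhatLT b u (simpleRefl b a * u)) :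
    (setS b u v = setS b u (simpleRefl b a * v) ∪ {-(v⁻¹ • P.root a)} ∧
      Disjoint (setS b u (simpleRefl b a * v)) {-(v⁻¹ • P.root a)}) ∧
    ∀ z : Torus X, IsRegular P z →
      bar (m b u v z) =
        (LaurentPolynomial.C (1 - z (-(v⁻¹ • P.root a)))⁻¹ *
            (1 - q * LaurentPolynomial.C (z (-(v⁻¹ • P.root a))))) *
          bar (m b u (simpleRefl b a * v) z) := by
  refine ⟨setS_eq_union huv.1 hv.length_lt hu.length_lt, fun z hz => ?_⟩
  rw [m_eq_mul hz hv.length_lt hu.length_lt, map_mul, map_mul, map_sub, map_one, map_mul, bar_qInv]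
  simp only [bar, LaurentPolynomial.invert_C]
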